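/- Let $n,m\ge 1$, $0<\alpha<1$, and let $X=(X_1,\dots,X_m):\mathbb{R}^n\to\mathbb{R}^m$ be index-$\alpha$ fractional Brownian motion on a probability space $(\Omega,\mathcal F,\mathbb P)$, that is, a Gaussian random function that is almost surely continuous with $X(0)=0$, whose coordinate processes $X_1,\dots,X_m$ are independent and have increments $X_i(x)-X_i(y)$ that are normally distributed with mean $0$ and variance $|x-y|^{2\alpha}$ for all $x,y\in\mathbb{R}^n$. Let $E\subset\mathbb{R}^n$ be non-empty and compact. Then, almost surely, $$\underline{\dim}_{\rm B}\, X(E)=\frac1\alpha\,\underline{\dim}_{\rm B}^{\,m\alpha} E\quad\text{and}\quad \overline{\dim}_{\rm B}\, X(E)=\frac1\alpha\,\overline{\dim}_{\rm B}^{\,m\alpha} E .$$ Here, for a non-empty compact set $A\subset\mathbb{R}^d$, $$\underline{\dim}_{\rm B} A=\varliminf_{r\to0^+}\frac{\log N_r(A)}{-\log r},\qquad \overline{\dim}_{\rm B} A=\varlimsup_{r\to0^+}\frac{\log N_r(A)}{-\log r},$$ where $N_r(A)$ is the minimum number of sets of diameter at most $r$ that can cover $A$. For $s>0$ the lower and upper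 $s$-box dimension profiles of $E$ are $$\underline{\dim}_{\rm B}^{\,s} E=\varliminf_{r\to0^+}\frac{\log C_r^s(E)}{-\log r},\qquad \overline{\dim}_{\rm B}^{\,s} E=\varlimsup_{r\to0^+}\frac{\log C_r^s(E)}{-\log r},$$ where the capacity $C_r^s(E)$ is given by $$\frac1{C_r^s(E)}=\inf_{\mu}\iint \phi_r^s(x-y)\,d\mu(x)\,d\mu(y),\qquad \phi_r^s(x)=\min\Big\{1,\Big(\frac{r}{|x|}\Big)^s\Big\},\quad \phi_r^s(0)=1,$$ the infimum being over all Borel probability measures $\mu$ supported by $E$. -/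

import Mathlib

open MeasureTheory ProbabilityTheory Filter Topology
open scoped ENNReal NNReal

namespace BoxProfile

/-- The minimum number `N_r(A)` of sets of diameter at most `r` that cover `A`
(`⊤` if no finite cover exists). -/
noncomputable def boxCount {d : ℕ} (r : ℝ) (A : Set (EuclideanSpace ℝ (Fin d))) : ℕ∞ :=
  ⨅ (k : ℕ) (_ : ∃ U : Fin k → Set (EuclideanSpace ℝ (Fin d)),
    (∀ i, Metric.ediam (U i) ≤ ENNReal.ofReal r) ∧ A ⊆ ⋃ i, U i), (k : ℕ∞)

/-- Lower box-counting dimension `liminf_{r → 0+} log N_r(A) / (-log r)`. -/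
noncomputable def lowerBoxDim {d : ℕ} (A : Set (EuclideanSpace ℝ (Fin d))) : EReal :=
  liminf (fun r : ℝ => ENNReal.log (boxCount r A : ℝ≥0∞) / ((-Real.log r : ℝ) : EReal)) (𝓝[>] 0)

/-- Upper box-counting dimension `limsup_{r → 0+} log N_r(A) / (-log r)`. -/
noncomputable def upperBoxDim {d : ℕ} (A : Set (EuclideanSpace ℝ (Fin d))) : EReal :=
  limsup (fun r : ℝ => ENNReal.log (boxCount r A : ℝ≥0∞) / ((-Real.log r : ℝ) : EReal)) (𝓝[>] 0)

open Classical in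
/-- The kernel `φ_r^s(x) = min {1, (r / |x|)^s}`, with value `1` at the origin. -/
noncomputable def kernel {n : ℕ} (s r : ℝ) (x : EuclideanSpace ℝ (Fin n)) : ℝ :=
  if x = 0 then 1 else min 1 ((r / ‖x‖) ^ s)

/-- The energy `∫∫ φ_r^s(x - y) dμ(x) dμ(y)` (the integrand is nonnegative when `r > 0`). -/
noncomputable def energy {n : ℕ} (s r : ℝ) (μ : Measure (EuclideanSpace ℝ (Fin n))) : ℝ≥0∞ :=
  ∫⁻ y, ∫⁻ x, ENNReal.ofReal (kernel s r (x - y)) ∂μ ∂μ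

/-- The capacity `C_r^s(E)`: the reciprocal of the infimum of the energies of the Borel
probability measures supported by (the closure of) `E`. -/
noncomputable def capacity {n : ℕ} (s r : ℝ) (E : Set (EuclideanSpace ℝ (Fin n))) : ℝ≥0∞ :=
  (⨅ (μ : Measure (EuclideanSpace ℝ (Fin n)))
    (_ : IsProbabilityMeasure μ ∧ μ (closure E)ᶜ = 0), energy s r μ)⁻¹

/-- Lower `s`-box dimension profile `liminf_{r → 0+} log C_r^s(E) / (-log r)`. -/
noncomputable def lowerProfile {n : ℕ} (s : ℝ) (E : Set (EuclideanSpace ℝ (Fin n))) : EReal :=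
  liminf (fun r : ℝ => ENNReal.log (capacity s r E) / ((-Real.log r : ℝ) : EReal)) (𝓝[>] 0)

/-- Upper `s`-box dimension profile `limsup_{r → 0+} log C_r^s(E) / (-log r)`. -/
noncomputable def upperProfile {n : ℕ} (s : ℝ) (E : Set (EuclideanSpace ℝ (Fin n))) : EReal :=
  limsup (fun r : ℝ => ENNReal.log (capacity s r E) / ((-Real.log r : ℝ) : EReal)) (𝓝[>] 0)

/-- `X` is index-`α` fractional Brownian motion `ℝⁿ → ℝᵐ` on the probability space `(Ω, P)`:
a Gaussian random function, almost surely continuous with `X 0 = 0`, whose coordinate processes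
are independent and have increments `X_i(x) - X_i(y)` that are normal with mean `0` and variance
`|x - y|^(2α)`. -/
structure IsFractionalBrownianMotion {n m : ℕ} {Ω : Type*} [MeasurableSpace Ω] (α : ℝ)
    (X : EuclideanSpace ℝ (Fin n) → Ω → EuclideanSpace ℝ (Fin m)) (P : Measure Ω) : Prop where
  measurable : ∀ x, Measurable (X x)
  gaussian : IsGaussianProcess X P
  continuous : ∀ᵐ ω ∂P, Continuous fun x => X x ω
  zero : ∀ᵐ ω ∂P, X 0 ω = 0
  indep : iIndepFun (fun (i : Fin m) (ω : Ω) (x : EuclideanSpace ℝ (Fin n)) => X x ω i) P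
  increment : ∀ (i : Fin m) (x y : EuclideanSpace ℝ (Fin n)),
    HasLaw (fun ω => X x ω i - X y ω i) (gaussianReal 0 (‖x - y‖₊ ^ (2 * α))) P

end BoxProfile

/-!
# Box dimensions of images under fractional Brownian motion

Let `N_r` denote covering numbers and `C_r` the capacities of exponent `m α`. Almost surely, up to
subpolynomial factors in `r`, one has `N_{r ^ α}(X(E)) ≈ C_r(E)`. Both dimension formulas follow by
taking logarithms (`limsup_logRatio_le`, `liminf_logRatio_le`), since a change of scale `r ↦ r ^ α`
divides exponents by `α`.

*Upper bound for the covering numbers.* A nearly optimal measure for the capacity has a potential of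
size at least `1 / (2 C_r)` at every point of `E` (`exists_measure_potential_ge`). Almost surely `X`
is `γ`-Hölder on `E` for every `γ < α` (`ae_exists_holder`, proved by chaining along dyadic lattices
from the moments of Gaussian increments). A Hölder map turns the kernel of exponent `m γ` at scale
`r` on `ℝⁿ` into the kernel of exponent `m` at scale `c r ^ γ` on `ℝᵐ`. Summing the potentials over
a maximal separated subset of the image bounds its cardinality, because the kernel of exponent `m`
summed over a separated set of `ℝᵐ` is only logarithmically large (`sum_kernel_le`). Capacities
increase with the exponent, so `m γ` may be replaced by `m α`, and `γ` tends to `α`.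

*Lower bound for the covering numbers.* By independence of the coordinates,
`P (|X x - X y| ≤ r)` is at most the kernel of exponent `m α` at scale `r ^ (1 / α)`
(`IsFractionalBrownianMotion.measure_norm_sub_le`). Hence for a nearly optimal measure `μ` the
expected probability that two independent `μ`-points have images within `r` is at most of order
`1 / C_{r ^ (1 / α)}`, while by Cauchy–Schwarz this probability is at least `1 / N_r(X(E))`
(`inv_correlation_le_boxCount`). Summing over the scales `r = 2 ^ (-k)` with weights
`(k + 1) ^ (-2)` turns this bound in mean into an almost sure one (`ae_capacity_le_boxCount`).
-/

/-! ### Growth exponents under a change of scale -/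

namespace BoxProfile

/-- Raising to a positive power is a change of variable near `0+`. -/
lemma map_rpow_nhdsGT_zero {κ : ℝ} (hκ : 0 < κ) :
    map (fun r : ℝ => r ^ κ) (𝓝[>] 0) = 𝓝[>] 0 := by
  have key : ∀ {c : ℝ}, 0 < c → Tendsto (fun r : ℝ => r ^ c) (𝓝[>] 0) (𝓝[>] 0) := by
    intro c hc
    refine tendsto_nhdsWithin_iff.2 ⟨?_, ?_⟩
    · have := (Real.continuousAt_rpow_const 0 c (Or.inr hc.le)).tendsto
      rw [Real.zero_rpow hc.ne'] at this
      exact this.mono_left nhdsWithin_le_nhds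
    · filter_upwards [self_mem_nhdsWithin] with r hr
      exact Real.rpow_pos_of_pos hr _
  refine le_antisymm (key hκ) ?_
  have h2 : Tendsto (fun r : ℝ => r ^ κ⁻¹) (𝓝[>] 0) (𝓝[>] 0) := key (inv_pos.2 hκ)
  calc 𝓝[>] (0 : ℝ) = map (fun r : ℝ => (r ^ κ⁻¹) ^ κ) (𝓝[>] 0) := by
        conv_lhs => rw [← map_id (f := 𝓝[>] (0 : ℝ))]
        refine Filter.map_congr ?_
        filter_upwards [self_mem_nhdsWithin] with r hr
        rw [id, Real.rpow_inv_rpow (le_of_lt hr) hκ.ne']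
    _ = map (fun r : ℝ => r ^ κ) (map (fun r : ℝ => r ^ κ⁻¹) (𝓝[>] 0)) := by
        rw [map_map]; rfl
    _ ≤ _ := map_mono h2

/-- The exponent `log f(r) / (-log r)` of a size function `f` at scale `r`. -/
noncomputable def logRatio (f : ℝ → ℝ≥0∞) (r : ℝ) : EReal :=
  ENNReal.log (f r) / ((-Real.log r : ℝ) : EReal)

lemma limsup_logRatio_rpow (f : ℝ → ℝ≥0∞) {κ : ℝ} (hκ : 0 < κ) :
    limsup (fun r : ℝ => logRatio f (r ^ κ)) (𝓝[>] 0) = limsup (logRatio f) (𝓝[>] 0) := by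
  conv_rhs => rw [← map_rpow_nhdsGT_zero hκ, ← limsup_comp]
  rfl

lemma liminf_logRatio_rpow (f : ℝ → ℝ≥0∞) {κ : ℝ} (hκ : 0 < κ) :
    liminf (fun r : ℝ => logRatio f (r ^ κ)) (𝓝[>] 0) = liminf (logRatio f) (𝓝[>] 0) := by
  conv_rhs => rw [← map_rpow_nhdsGT_zero hκ, ← liminf_comp]
  rfl

/-- One scale of the comparison: a factor `r ^ (-ε)` costs `ε` in the exponent, and the change of
scale `r ↦ r ^ κ` divides the exponent by `κ`. -/
lemma logRatio_rpow_le {f g : ℝ → ℝ≥0∞} {κ ε r : ℝ} (hκ : 0 < κ) (hr : 0 < r) (hr1 : r < 1)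
    (h : f (r ^ κ) ≤ ENNReal.ofReal (r ^ (-ε)) * g r) :
    logRatio f (r ^ κ) ≤ ((κ⁻¹ : ℝ) : EReal) * (logRatio g r + (ε : EReal)) := by
  have hl : 0 < -Real.log r := by have := Real.log_neg hr hr1; linarith
  have h1 : ENNReal.log (f (r ^ κ)) ≤ ((-ε * Real.log r : ℝ) : EReal) + ENNReal.log (g r) := by
    refine (ENNReal.log_le_log h).trans_eq ?_
    rw [ENNReal.log_mul_add, ENNReal.log_ofReal_of_pos (Real.rpow_pos_of_pos hr _),
      Real.log_rpow hr]
  unfold logRatio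
  have hκl : 0 < -(κ * Real.log r) := by nlinarith
  rw [Real.log_rpow hr, EReal.div_le_iff_le_mul (by exact_mod_cast hκl) (EReal.coe_ne_top _)]
  refine h1.trans_eq ?_
  generalize ENNReal.log (g r) = x
  induction x with
  | bot =>
    rw [EReal.bot_div_of_pos_ne_top (by exact_mod_cast hl) (EReal.coe_ne_top _), EReal.bot_add,
      EReal.add_bot, EReal.coe_mul_bot_of_pos (inv_pos.2 hκ),
      EReal.coe_mul_bot_of_pos (by nlinarith)]
  | top =>
    rw [EReal.top_div_of_pos_ne_top (by exact_mod_cast hl) (EReal.coe_ne_top _),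
      EReal.coe_add_top, EReal.top_add_coe, EReal.coe_mul_top_of_pos (inv_pos.2 hκ),
      EReal.coe_mul_top_of_pos (by nlinarith)]
  | coe x =>
    rw [← EReal.coe_div]
    norm_cast
    have : Real.log r ≠ 0 := fun h0 => by rw [h0] at hl; simp at hl
    field_simp
    ring

lemma monotone_mul_add {κ : ℝ} (hκ : 0 < κ) (ε : ℝ) :
    Monotone (fun x : EReal => ((κ⁻¹ : ℝ) : EReal) * (x + (ε : EReal))) := by
  intro x y hxy
  exact mul_le_mul_of_nonneg_left (add_le_add hxy le_rfl)
    (by exact_mod_cast (inv_pos.2 hκ).le)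

lemma continuous_mul_add {κ : ℝ} (hκ : 0 < κ) (ε : ℝ) :
    Continuous (fun x : EReal => ((κ⁻¹ : ℝ) : EReal) * (x + (ε : EReal))) := by
  have hκ' : κ⁻¹ ≠ 0 := (inv_pos.2 hκ).ne'
  refine continuous_iff_continuousAt.2 fun x => ?_
  have hadd : ContinuousAt (fun x : EReal => x + (ε : EReal)) x :=
    ContinuousAt.comp (f := fun x : EReal => (x, (ε : EReal)))
      (EReal.continuousAt_add (p := (x, (ε : EReal))) (by simp) (by simp))
      (by fun_prop)
  have hmul : ContinuousAt (fun y : EReal => ((κ⁻¹ : ℝ) : EReal) * y) (x + (ε : EReal)) :=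
    ContinuousAt.comp (f := fun y : EReal => (((κ⁻¹ : ℝ) : EReal), y))
      (EReal.continuousAt_mul (p := (((κ⁻¹ : ℝ) : EReal), x + (ε : EReal)))
        (Or.inl (EReal.coe_ne_zero.2 hκ')) (Or.inl (EReal.coe_ne_zero.2 hκ')) (by simp) (by simp))
      (by fun_prop)
  exact ContinuousAt.comp (g := fun y : EReal => ((κ⁻¹ : ℝ) : EReal) * y) hmul hadd

/-- Letting the loss `ε` tend to `0`. -/
lemma le_inv_mul_of_forall_loss {θ : ℝ} (hθ : 0 < θ) {a L : EReal}
    (h : ∀ ε : ℝ, 0 < ε → ε < 1 → a ≤ (((θ * (1 - ε))⁻¹ : ℝ) : EReal) * (L + (ε : EReal))) :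
    a ≤ ((1 / θ : ℝ) : EReal) * L := by
  induction L with
  | bot =>
    have := h (1 / 2) (by norm_num) (by norm_num)
    rw [EReal.bot_add, EReal.coe_mul_bot_of_pos (by positivity)] at this
    rwa [EReal.coe_mul_bot_of_pos (by positivity)]
  | top => rw [EReal.coe_mul_top_of_pos (by positivity)]; exact le_top
  | coe L =>
    have hlim : Tendsto (fun ε : ℝ => (((θ * (1 - ε))⁻¹ * (L + ε) : ℝ) : EReal)) (𝓝[>] 0)
        (𝓝 ((1 / θ * L : ℝ) : EReal)) := by
      refine (continuous_coe_real_ereal.tendsto _).comp ?_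
      have : ContinuousAt (fun ε : ℝ => (θ * (1 - ε))⁻¹ * (L + ε)) 0 := by
        refine ContinuousAt.mul (ContinuousAt.inv₀ (by fun_prop) (by simpa using hθ.ne'))
          (by fun_prop)
      have h2 := this.tendsto
      simp only [sub_zero, mul_one, add_zero] at h2
      rw [one_div]
      exact h2.mono_left nhdsWithin_le_nhds
    have := ge_of_tendsto (b := a) hlim ?_
    · exact_mod_cast this
    · filter_upwards [Ioo_mem_nhdsGT (zero_lt_one' ℝ)] with ε hε
      exact_mod_cast h ε hε.1 hε.2

section Comparison

variable {f g : ℝ → ℝ≥0∞} {θ : ℝ}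

lemma limsup_logRatio_le (hθ : 0 < θ)
    (h : ∀ ε : ℝ, 0 < ε → ε < 1 →
      ∀ᶠ r in 𝓝[>] (0 : ℝ), f (r ^ (θ * (1 - ε))) ≤ ENNReal.ofReal (r ^ (-ε)) * g r) :
    limsup (logRatio f) (𝓝[>] 0) ≤ ((1 / θ : ℝ) : EReal) * limsup (logRatio g) (𝓝[>] 0) := by
  refine le_inv_mul_of_forall_loss hθ fun ε h0 h1 => ?_
  have hκ : 0 < θ * (1 - ε) := mul_pos hθ (by linarith)
  rw [← limsup_logRatio_rpow f hκ, (monotone_mul_add hκ ε).map_limsup_of_continuousAt _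
    (continuous_mul_add hκ ε).continuousAt]
  refine limsup_le_limsup ?_
  filter_upwards [h ε h0 h1, Ioo_mem_nhdsGT (zero_lt_one' ℝ)] with r hr hr1
  exact logRatio_rpow_le hκ hr1.1 hr1.2 hr

lemma liminf_logRatio_le (hθ : 0 < θ)
    (h : ∀ ε : ℝ, 0 < ε → ε < 1 →
      ∀ᶠ r in 𝓝[>] (0 : ℝ), f (r ^ (θ * (1 - ε))) ≤ ENNReal.ofReal (r ^ (-ε)) * g r) :
    liminf (logRatio f) (𝓝[>] 0) ≤ ((1 / θ : ℝ) : EReal) * liminf (logRatio g) (𝓝[>] 0) := by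
  refine le_inv_mul_of_forall_loss hθ fun ε h0 h1 => ?_
  have hκ : 0 < θ * (1 - ε) := mul_pos hθ (by linarith)
  rw [← liminf_logRatio_rpow f hκ, (monotone_mul_add hκ ε).map_liminf_of_continuousAt _
    (continuous_mul_add hκ ε).continuousAt]
  refine liminf_le_liminf ?_
  filter_upwards [h ε h0 h1, Ioo_mem_nhdsGT (zero_lt_one' ℝ)] with r hr hr1
  exact logRatio_rpow_le hκ hr1.1 hr1.2 hr

end Comparison

end BoxProfile

/-! ### Kernels, capacities and covering numbers -/

namespace BoxProfile

section Kernel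

variable {n : ℕ} {s r : ℝ}

@[simp] lemma kernel_zero : kernel s r (0 : EuclideanSpace ℝ (Fin n)) = 1 := if_pos rfl

lemma kernel_of_ne {x : EuclideanSpace ℝ (Fin n)} (hx : x ≠ 0) :
    kernel s r x = min 1 ((r / ‖x‖) ^ s) := if_neg hx

lemma kernel_nonneg (hr : 0 ≤ r) (x : EuclideanSpace ℝ (Fin n)) : 0 ≤ kernel s r x := by
  by_cases hx : x = 0
  · simp [hx]
  · rw [kernel_of_ne hx]; positivity

lemma kernel_le_one (x : EuclideanSpace ℝ (Fin n)) : kernel s r x ≤ 1 := by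
  by_cases hx : x = 0
  · simp [hx]
  · rw [kernel_of_ne hx]; exact min_le_left _ _

lemma kernel_neg (x : EuclideanSpace ℝ (Fin n)) : kernel s r (-x) = kernel s r x := by
  by_cases hx : x = 0
  · simp [hx]
  · rw [kernel_of_ne hx, kernel_of_ne (neg_ne_zero.2 hx), norm_neg]

lemma kernel_sub_comm (x y : EuclideanSpace ℝ (Fin n)) :
    kernel s r (x - y) = kernel s r (y - x) := by rw [← kernel_neg, neg_sub]

@[fun_prop]
lemma measurable_kernel : Measurable (kernel s r : EuclideanSpace ℝ (Fin n) → ℝ) := by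
  unfold kernel
  exact Measurable.ite (measurableSet_singleton 0) measurable_const (by fun_prop)

lemma kernel_mono_radius (hs : 0 ≤ s) (hr : 0 ≤ r) {r' : ℝ} (h : r ≤ r')
    (x : EuclideanSpace ℝ (Fin n)) : kernel s r x ≤ kernel s r' x := by
  by_cases hx : x = 0
  · simp [hx]
  · rw [kernel_of_ne hx, kernel_of_ne hx]
    gcongr

lemma kernel_antitone_exponent (hr : 0 < r) {s' : ℝ} (h0 : 0 ≤ s') (hs : s' ≤ s)
    (x : EuclideanSpace ℝ (Fin n)) : kernel s r x ≤ kernel s' r x := by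
  by_cases hx : x = 0
  · simp [hx]
  · rw [kernel_of_ne hx, kernel_of_ne hx]
    have ht : 0 < r / ‖x‖ := by positivity
    rcases le_total (r / ‖x‖) 1 with h1 | h1
    · exact min_le_min le_rfl (Real.rpow_le_rpow_of_exponent_ge ht h1 hs)
    · rw [min_eq_left (Real.one_le_rpow h1 h0)]; exact min_le_left _ _

/-- The kernel dominates a positive constant on bounded sets. -/
lemma le_kernel_of_norm_le (hs : 0 ≤ s) (hr : 0 ≤ r) {D : ℝ} {x : EuclideanSpace ℝ (Fin n)}
    (hx : ‖x‖ ≤ D) : min 1 ((r / D) ^ s) ≤ kernel s r x := by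
  by_cases h0 : x = 0
  · rw [h0, kernel_zero]; exact min_le_left _ _
  · rw [kernel_of_ne h0]
    have : 0 < ‖x‖ := norm_pos_iff.2 h0
    have : 0 ≤ r / D := div_nonneg hr (this.le.trans hx)
    gcongr

/-- A `γ`-Hölder map with constant `c` turns the kernel of exponent `m γ` at scale `r` into at most
the kernel of exponent `m` at scale `c r ^ γ`. -/
lemma kernel_le_kernel_of_holder {m : ℕ} {γ c t : ℝ} (hγ : 0 < γ) (ht : 0 ≤ t) (hr : 0 ≤ r)
    {x : EuclideanSpace ℝ (Fin n)} {y : EuclideanSpace ℝ (Fin m)}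
    (h : ‖y‖ ≤ c * ‖x‖ ^ γ) : kernel (t * γ) r x ≤ kernel t (c * r ^ γ) y := by
  by_cases hy : y = 0
  · rw [hy, kernel_zero]; exact kernel_le_one x
  have hx : x ≠ 0 := by
    rintro rfl
    rw [norm_zero, Real.zero_rpow hγ.ne', mul_zero] at h
    exact hy (norm_le_zero_iff.1 h)
  rw [kernel_of_ne hx, kernel_of_ne hy]
  refine min_le_min le_rfl ?_
  have hy' : 0 < ‖y‖ := norm_pos_iff.2 hy
  have hx' : 0 < ‖x‖ := norm_pos_iff.2 hx
  rw [mul_comm t, Real.rpow_mul (by positivity)]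
  refine Real.rpow_le_rpow (by positivity) ?_ ht
  rw [Real.div_rpow hr hx'.le, div_le_div_iff₀ (by positivity) hy']
  calc r ^ γ * ‖y‖ ≤ r ^ γ * (c * ‖x‖ ^ γ) := by gcongr
    _ = _ := by ring

end Kernel

section BoxCount

variable {d : ℕ}

lemma boxCount_anti (A : Set (EuclideanSpace ℝ (Fin d))) :
    Antitone (fun r : ℝ => boxCount r A) := by
  intro r r' h
  refine iInf_mono fun k => iInf_mono' ?_
  rintro ⟨U, hU, hA⟩
  exact ⟨⟨U, fun i => (hU i).trans (ENNReal.ofReal_le_ofReal h), hA⟩, le_rfl⟩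

lemma boxCount_le_card {r : ℝ} {A : Set (EuclideanSpace ℝ (Fin d))}
    {T : Finset (EuclideanSpace ℝ (Fin d))} (h : A ⊆ ⋃ z ∈ T, Metric.closedBall z r) :
    boxCount (2 * r) A ≤ T.card := by
  refine iInf₂_le _ ⟨fun i => Metric.closedBall (T.equivFin.symm i : EuclideanSpace ℝ (Fin d)) r,
    fun i => ?_, fun x hx => ?_⟩
  · refine (Metric.ediam_le_of_forall_dist_le fun x hx y hy => ?_)
    have := dist_triangle_right x y (T.equivFin.symm i : EuclideanSpace ℝ (Fin d))
    rw [Metric.mem_closedBall] at hx hy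
    linarith
  · obtain ⟨z, hz, hxz⟩ := Set.mem_iUnion₂.1 (h hx)
    exact Set.mem_iUnion.2 ⟨T.equivFin ⟨z, hz⟩, by simpa using hxz⟩

end BoxCount

section Capacity

variable {n : ℕ} {s r : ℝ} {E : Set (EuclideanSpace ℝ (Fin n))}

lemma capacity_anti_radius (hs : 0 ≤ s) (hr : 0 ≤ r) {r' : ℝ} (h : r ≤ r') :
    capacity s r' E ≤ capacity s r E := by
  refine ENNReal.inv_le_inv.2 (iInf₂_mono fun μ _ => ?_)
  exact lintegral_mono fun y => lintegral_mono fun x =>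
    ENNReal.ofReal_le_ofReal (kernel_mono_radius hs hr h _)

lemma capacity_mono_exponent (hr : 0 < r) {s' : ℝ} (h0 : 0 ≤ s') (h : s' ≤ s) :
    capacity s' r E ≤ capacity s r E := by
  refine ENNReal.inv_le_inv.2 (iInf₂_mono fun μ _ => ?_)
  exact lintegral_mono fun y => lintegral_mono fun x =>
    ENNReal.ofReal_le_ofReal (kernel_antitone_exponent hr h0 h _)

/-- Energies are bounded below, so the capacity is finite. -/
lemma exists_pos_le_energy (hs : 0 ≤ s) (hr : 0 < r) (hE : IsCompact E) :
    ∃ κ : ℝ, 0 < κ ∧ ∀ μ : Measure (EuclideanSpace ℝ (Fin n)), IsProbabilityMeasure μ →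
      μ Eᶜ = 0 → ENNReal.ofReal κ ≤ energy s r μ := by
  refine ⟨min 1 ((r / (Metric.diam E + 1)) ^ s), ?_, fun μ hμ hμE => ?_⟩
  · have : 0 ≤ Metric.diam E := Metric.diam_nonneg
    positivity
  have hae : ∀ᵐ x ∂μ, x ∈ E := hμE
  calc ENNReal.ofReal (min 1 ((r / (Metric.diam E + 1)) ^ s))
      = ∫⁻ _, ∫⁻ _, ENNReal.ofReal (min 1 ((r / (Metric.diam E + 1)) ^ s)) ∂μ ∂μ := by simp
    _ ≤ energy s r μ := by
      refine lintegral_mono_ae ?_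
      filter_upwards [hae] with y hy
      refine lintegral_mono_ae ?_
      filter_upwards [hae] with x hx
      refine ENNReal.ofReal_le_ofReal (le_kernel_of_norm_le hs hr.le ?_)
      rw [← dist_eq_norm]
      exact (Metric.dist_le_diam_of_mem hE.isBounded hx hy).trans (by linarith)

lemma energy_le_one (μ : Measure (EuclideanSpace ℝ (Fin n))) [IsProbabilityMeasure μ] :
    energy s r μ ≤ 1 := by
  calc energy s r μ ≤ ∫⁻ _, ∫⁻ _, 1 ∂μ ∂μ := by
        refine lintegral_mono fun y => lintegral_mono fun x => ?_
        exact ENNReal.ofReal_le_one.2 (kernel_le_one _)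
    _ = 1 := by simp

lemma inv_capacity_le_one (hne : E.Nonempty) : (capacity s r E)⁻¹ ≤ 1 := by
  obtain ⟨x, hx⟩ := hne
  rw [capacity, inv_inv]
  exact (iInf₂_le (Measure.dirac x)
    ⟨inferInstance, by simp [subset_closure hx]⟩).trans (energy_le_one _)

lemma inv_capacity_le_energy (hE : IsClosed E) {μ : Measure (EuclideanSpace ℝ (Fin n))}
    [hμ : IsProbabilityMeasure μ] (h : μ Eᶜ = 0) : (capacity s r E)⁻¹ ≤ energy s r μ := by
  rw [capacity, inv_inv]
  exact iInf₂_le μ ⟨hμ, by rwa [hE.closure_eq]⟩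

lemma exists_energy_lt (hE : IsClosed E) {a : ℝ≥0∞} (ha : (capacity s r E)⁻¹ < a) :
    ∃ μ : Measure (EuclideanSpace ℝ (Fin n)), IsProbabilityMeasure μ ∧ μ Eᶜ = 0 ∧
      energy s r μ < a := by
  rw [capacity, inv_inv] at ha
  obtain ⟨μ, hμ⟩ := iInf_lt_iff.1 ha
  obtain ⟨⟨h1, h2⟩, h3⟩ := iInf_lt_iff.1 hμ
  exact ⟨μ, h1, by rwa [hE.closure_eq] at h2, h3⟩

/-- Some probability measure on `E` has energy at most twice the infimum. -/
lemma exists_measure_energy_le (hs : 0 ≤ s) (hr : 0 < r) (hE : IsCompact E) (hne : E.Nonempty) :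
    ∃ μ : Measure (EuclideanSpace ℝ (Fin n)), IsProbabilityMeasure μ ∧ μ Eᶜ = 0 ∧
      capacity s r E * energy s r μ ≤ 2 := by
  have h0 : (capacity s r E)⁻¹ ≠ 0 := by
    obtain ⟨κ, hκ, h⟩ := exists_pos_le_energy (s := s) hs hr hE
    have : ENNReal.ofReal κ ≤ (capacity s r E)⁻¹ := by
      rw [capacity, inv_inv]
      exact le_iInf₂ fun μ hμ => h μ hμ.1 (by rw [← hE.isClosed.closure_eq]; exact hμ.2)
    exact ((ENNReal.ofReal_pos.2 hκ).trans_le this).ne'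
  have h1 : (capacity s r E)⁻¹ ≠ ⊤ := ((inv_capacity_le_one hne).trans_lt ENNReal.one_lt_top).ne
  obtain ⟨μ, hμ, hμE, hlt⟩ := exists_energy_lt (s := s) (r := r) hE.isClosed
    (a := 2 * (capacity s r E)⁻¹) (by
      rw [two_mul]; exact ENNReal.lt_add_right h1 h0)
  refine ⟨μ, hμ, hμE, ?_⟩
  calc capacity s r E * energy s r μ ≤ capacity s r E * (2 * (capacity s r E)⁻¹) := by gcongr
    _ = 2 * (capacity s r E * (capacity s r E)⁻¹) := by ring
    _ ≤ 2 * 1 := by gcongr; exact ENNReal.mul_inv_le_one _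
    _ = 2 := mul_one _

lemma energy_mix (μ : Measure (EuclideanSpace ℝ (Fin n)))
    {a b : ℝ≥0∞} (ha : a ≠ ⊤) (hb : b ≠ ⊤) (x₀ : EuclideanSpace ℝ (Fin n)) :
    energy s r (a • μ + b • Measure.dirac x₀) =
      a * (a * energy s r μ + b * ∫⁻ y, ENNReal.ofReal (kernel s r (x₀ - y)) ∂μ) +
      b * (a * (∫⁻ y, ENNReal.ofReal (kernel s r (x₀ - y)) ∂μ) + b) := by
  have hsymm : ∫⁻ x, ENNReal.ofReal (kernel s r (x - x₀)) ∂μ =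
      ∫⁻ y, ENNReal.ofReal (kernel s r (x₀ - y)) ∂μ := by
    simp_rw [kernel_sub_comm (s := s) (r := r) _ x₀]
  simp only [energy, lintegral_add_measure, lintegral_smul_measure, lintegral_dirac, smul_eq_mul]
  rw [lintegral_add_right _ (by fun_prop), lintegral_const_mul' _ _ ha, lintegral_const_mul' _ _ hb,
    hsymm]
  simp

/-- Some probability measure on `E` has a potential that is at least half the minimal energy
throughout `E`: moving a little mass to a point of lower potential would decrease the energy. -/
lemma exists_measure_potential_ge (hE : IsClosed E) (hne : E.Nonempty) :
    ∃ μ : Measure (EuclideanSpace ℝ (Fin n)), IsProbabilityMeasure μ ∧ μ Eᶜ = 0 ∧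
      ∀ x ∈ E, (capacity s r E)⁻¹ / 2 ≤ ∫⁻ y, ENNReal.ofReal (kernel s r (x - y)) ∂μ := by
  set I := (capacity s r E)⁻¹ with hI
  rcases eq_or_ne I 0 with h0 | h0
  · obtain ⟨x, hx⟩ := hne
    exact ⟨Measure.dirac x, inferInstance, by simp [hx], by simp [h0]⟩
  have hI1 : I ≤ 1 := inv_capacity_le_one hne
  have hItop : I ≠ ⊤ := (hI1.trans_lt ENNReal.one_lt_top).ne
  set i := I.toReal with hi
  have hi0 : 0 < i := ENNReal.toReal_pos h0 hItop
  have hi1 : i ≤ 1 := ENNReal.toReal_mono ENNReal.one_ne_top hI1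
  obtain ⟨μ, hμ, hμE, hlt⟩ := exists_energy_lt (s := s) (r := r) hE
    (a := I + ENNReal.ofReal (i ^ 2 / 8))
    (ENNReal.lt_add_right hItop (ENNReal.ofReal_pos.2 (by positivity)).ne')
  refine ⟨μ, hμ, hμE, fun x₀ hx₀ => ?_⟩
  by_contra! hU
  -- Moving mass `i / 2` to `x₀` lowers the energy below its infimum.
  set U := ∫⁻ y, ENNReal.ofReal (kernel s r (x₀ - y)) ∂μ with hUdef
  have hUtop : U ≠ ⊤ := (hU.trans_le le_top).ne
  have hetop : energy s r μ ≠ ⊤ := (hlt.trans_le le_top).ne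
  have ht : 0 ≤ 1 - i / 2 := by linarith
  have hν : IsProbabilityMeasure
      (ENNReal.ofReal (1 - i / 2) • μ + ENNReal.ofReal (i / 2) • Measure.dirac x₀) :=
    ⟨by simp [← ENNReal.ofReal_add ht (by positivity : (0 : ℝ) ≤ i / 2)]⟩
  have hle : I ≤ energy s r
      (ENNReal.ofReal (1 - i / 2) • μ + ENNReal.ofReal (i / 2) • Measure.dirac x₀) :=
    inv_capacity_le_energy hE (by simp [hμE, hx₀])
  rw [energy_mix μ ENNReal.ofReal_ne_top ENNReal.ofReal_ne_top, ← hUdef] at hle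
  have hU' : U.toReal < i / 2 := by
    have := (ENNReal.toReal_lt_toReal hUtop (ENNReal.div_ne_top hItop (by simp))).2 hU
    simpa using this
  have he : (energy s r μ).toReal < i + i ^ 2 / 8 := by
    have := (ENNReal.toReal_lt_toReal hetop (by simp [hItop])).2 hlt
    rwa [ENNReal.toReal_add hItop ENNReal.ofReal_ne_top,
      ENNReal.toReal_ofReal (by positivity)] at this
  rw [← ENNReal.ofReal_toReal hUtop, ← ENNReal.ofReal_toReal hetop,
    ← ENNReal.ofReal_toReal hItop] at hle
  have hU0 : 0 ≤ U.toReal := ENNReal.toReal_nonneg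
  have he0 : 0 ≤ (energy s r μ).toReal := ENNReal.toReal_nonneg
  have hi2 : 0 ≤ i / 2 := by positivity
  generalize U.toReal = u at *
  generalize (energy s r μ).toReal = e at *
  rw [← ENNReal.ofReal_mul ht, ← ENNReal.ofReal_mul hi2, ← ENNReal.ofReal_mul ht,
    ← ENNReal.ofReal_add (by positivity) (by positivity),
    ← ENNReal.ofReal_add (by positivity) (by positivity), ← ENNReal.ofReal_mul ht,
    ← ENNReal.ofReal_mul hi2, ← ENNReal.ofReal_add (by positivity) (by positivity),
    ENNReal.ofReal_le_ofReal_iff (by positivity), ← hi] at hle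
  nlinarith [mul_nonneg ht hi2, mul_le_mul_of_nonneg_left he.le (mul_nonneg ht ht),
    mul_le_mul_of_nonneg_left hU'.le (mul_nonneg ht hi2), mul_nonneg ht (sq_nonneg i),
    mul_nonneg hi2 (sq_nonneg i)]

end Capacity

end BoxProfile

/-! ### Covering a Hölder image -/

namespace BoxProfile

section Packing

variable {m : ℕ} {δ : ℝ} {T : Finset (EuclideanSpace ℝ (Fin m))} {w : EuclideanSpace ℝ (Fin m)}

/-- Volume bound for the cardinality of a `δ`-separated set in a ball of radius `R δ`. -/
lemma card_le_of_separated_of_dist_le (hδ : 0 < δ) {R : ℝ} (hR : 0 ≤ R)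
    (hT : ∀ z ∈ T, dist z w ≤ R * δ)
    (hsep : (T : Set (EuclideanSpace ℝ (Fin m))).Pairwise fun z z' => δ ≤ dist z z') :
    (T.card : ℝ) ≤ (2 * R + 1) ^ m := by
  let μ : Measure (EuclideanSpace ℝ (Fin m)) := volume
  have hdisj : (T : Set (EuclideanSpace ℝ (Fin m))).Pairwise
      (Function.onFun Disjoint fun z => Metric.ball z (δ / 2)) := fun z hz z' hz' hne =>
    Metric.ball_disjoint_ball (by linarith [hsep hz hz' hne])
  have hsub : ⋃ z ∈ T, Metric.ball z (δ / 2) ⊆ Metric.ball w ((2 * R + 1) * (δ / 2)) := by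
    refine Set.iUnion₂_subset fun z hz => Metric.ball_subset_ball' ?_
    linarith [hT z hz]
  have hvol : (T.card : ℝ≥0∞) * ENNReal.ofReal ((δ / 2) ^ m) * μ (Metric.ball 0 1) ≤
      ENNReal.ofReal (((2 * R + 1) * (δ / 2)) ^ m) * μ (Metric.ball 0 1) := by
    calc _ = μ (⋃ z ∈ T, Metric.ball z (δ / 2)) := by
          rw [measure_biUnion_finset hdisj fun _ _ => measurableSet_ball]
          simp only [μ.addHaar_ball_of_pos _ (half_pos hδ), Finset.sum_const, nsmul_eq_mul,
            mul_assoc, finrank_euclideanSpace, Fintype.card_fin]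
      _ ≤ μ (Metric.ball w ((2 * R + 1) * (δ / 2))) := measure_mono hsub
      _ = _ := by
          rw [μ.addHaar_ball_of_pos _ (by positivity), finrank_euclideanSpace, Fintype.card_fin]
  have h := (ENNReal.mul_le_mul_iff_left (Metric.measure_ball_pos μ _ zero_lt_one).ne'
    measure_ball_lt_top.ne).1 hvol
  rw [mul_pow, ← ENNReal.ofReal_natCast, ← ENNReal.ofReal_mul (by positivity),
    ENNReal.ofReal_le_ofReal_iff (by positivity)] at h
  exact le_of_mul_le_mul_right h (by positivity)

/-- Dyadic decomposition of the kernel of exponent `m`. -/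
lemma kernel_le_sum_dyadic (hδ : 0 < δ) {K : ℕ} {v : EuclideanSpace ℝ (Fin m)}
    (hv : ‖v‖ ≤ 2 ^ K * δ) :
    kernel m δ v ≤
      ∑ k ∈ Finset.range (K + 1), if ‖v‖ ≤ 2 ^ k * δ then (2 / 2 ^ k : ℝ) ^ m else 0 := by
  classical
  have hex : ∃ k : ℕ, ‖v‖ ≤ 2 ^ k * δ := ⟨K, hv⟩
  set k := Nat.find hex with hk
  have hkv : ‖v‖ ≤ 2 ^ k * δ := Nat.find_spec hex
  have hkK : k ≤ K := Nat.find_min' hex hv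
  have hterm : kernel m δ v ≤ (2 / 2 ^ k : ℝ) ^ m := by
    rcases Nat.eq_zero_or_eq_succ_pred k with h0 | h0
    · rw [h0]
      exact (kernel_le_one v).trans (one_le_pow₀ (by norm_num))
    · set j := k.pred
      have hj : 2 ^ j * δ < ‖v‖ := not_le.1 (Nat.find_min hex (by omega))
      have hv0 : 0 < ‖v‖ := (by positivity : 0 < 2 ^ j * δ).trans hj
      rw [kernel_of_ne (norm_pos_iff.1 hv0), Real.rpow_natCast, h0, Nat.succ_eq_add_one, pow_succ]
      refine (min_le_right _ _).trans (pow_le_pow_left₀ (by positivity) ?_ _)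
      rw [div_le_div_iff₀ hv0 (by positivity)]
      nlinarith
  refine hterm.trans ?_
  rw [← if_pos (c := ‖v‖ ≤ 2 ^ k * δ) (t := (2 / 2 ^ k : ℝ) ^ m) (e := 0) hkv]
  exact Finset.single_le_sum (f := fun k => if ‖v‖ ≤ 2 ^ k * δ then (2 / 2 ^ k : ℝ) ^ m else 0)
    (fun k _ => by positivity) (Finset.mem_range.2 (by omega))

/-- The kernel of exponent equal to the dimension, summed over a separated set, grows only
logarithmically with the diameter: every dyadic shell contributes a bounded amount. -/
lemma sum_kernel_le (hδ : 0 < δ) {K : ℕ} (hT : ∀ z ∈ T, dist z w ≤ 2 ^ K * δ)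
    (hsep : (T : Set (EuclideanSpace ℝ (Fin m))).Pairwise fun z z' => δ ≤ dist z z') :
    ∑ z ∈ T, kernel m δ (z - w) ≤ 8 ^ m * (K + 1) := by
  classical
  calc ∑ z ∈ T, kernel m δ (z - w)
      ≤ ∑ z ∈ T, ∑ k ∈ Finset.range (K + 1),
          if ‖z - w‖ ≤ 2 ^ k * δ then (2 / 2 ^ k : ℝ) ^ m else 0 :=
        Finset.sum_le_sum fun z hz => kernel_le_sum_dyadic hδ (by
          rw [← dist_eq_norm]; exact hT z hz)
    _ = ∑ k ∈ Finset.range (K + 1),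
          ((T.filter fun z => ‖z - w‖ ≤ 2 ^ k * δ).card : ℝ) * (2 / 2 ^ k : ℝ) ^ m := by
        rw [Finset.sum_comm]
        refine Finset.sum_congr rfl fun k _ => ?_
        rw [← Finset.sum_filter, Finset.sum_const, nsmul_eq_mul]
    _ ≤ ∑ k ∈ Finset.range (K + 1), (8 : ℝ) ^ m := by
        refine Finset.sum_le_sum fun k _ => ?_
        have hcard : ((T.filter fun z => ‖z - w‖ ≤ 2 ^ k * δ).card : ℝ) ≤
            (2 * 2 ^ k + 1) ^ m := by
          refine card_le_of_separated_of_dist_le (w := w) hδ (by positivity) (fun z hz => ?_)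
            (hsep.mono fun z hz => (Finset.mem_filter.1 hz).1)
          rw [dist_eq_norm]
          exact (Finset.mem_filter.1 hz).2
        have h1 : (1 : ℝ) ≤ 2 ^ k := one_le_pow₀ (by norm_num)
        calc _ ≤ ((4 * 2 ^ k : ℝ)) ^ m * (2 / 2 ^ k : ℝ) ^ m := by
              gcongr
              exact hcard.trans (pow_le_pow_left₀ (by positivity) (by linarith) _)
          _ = 8 ^ m := by
              rw [← mul_pow]; congr 1; field_simp; norm_num
    _ = 8 ^ m * (K + 1) := by simp [mul_comm]

end Packing

/-- A totally bounded set has a finite `δ`-separated subset whose `δ`-balls cover it. -/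
lemma exists_finset_separated_cover {d : ℕ} {A : Set (EuclideanSpace ℝ (Fin d))}
    (hA : TotallyBounded A) {δ : ℝ} (hδ : 0 < δ) :
    ∃ T : Finset (EuclideanSpace ℝ (Fin d)), (T : Set (EuclideanSpace ℝ (Fin d))) ⊆ A ∧
      (T : Set (EuclideanSpace ℝ (Fin d))).Pairwise (fun z z' => δ ≤ dist z z') ∧
      A ⊆ ⋃ z ∈ T, Metric.closedBall z δ := by
  lift δ to ℝ≥0 using hδ.le
  have hδ' : 0 < δ := by exact_mod_cast hδ
  have hfin : Metric.packingNumber δ A ≠ ⊤ := by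
    obtain ⟨N, -, hNfin, hN⟩ :=
      Metric.exists_finite_isCover_of_totallyBounded (half_pos hδ').ne' hA
    have h := (Metric.packingNumber_two_mul_le_externalCoveringNumber (δ / 2) A).trans
      hN.externalCoveringNumber_le_encard
    rw [mul_div_cancel₀ _ (two_ne_zero' ℝ≥0)] at h
    exact (h.trans_lt (Set.encard_lt_top_iff.2 hNfin)).ne
  have hS : (Metric.maximalSeparatedSet δ A).Finite :=
    Set.encard_ne_top_iff.1 (by rwa [Metric.encard_maximalSeparatedSet hfin])
  refine ⟨hS.toFinset, by simpa using Metric.maximalSeparatedSet_subset, ?_, ?_⟩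
  · intro z hz z' hz' hne
    have : (δ : ℝ≥0∞) < edist z z' := Metric.isSeparated_maximalSeparatedSet (ε := δ) (A := A)
      (by simpa using hz) (by simpa using hz') hne
    rw [edist_nndist] at this
    exact_mod_cast this.le
  · have := Metric.isCover_iff_subset_iUnion_closedBall.1 (Metric.isCover_maximalSeparatedSet hfin)
    simpa using this

/-- Deterministic upper bound: the covering numbers of the image under a `γ`-Hölder map are
controlled by the capacities of exponent `m γ`, up to a logarithmic factor. -/
lemma boxCount_image_le {n m : ℕ} {γ c r : ℝ} (hγ : 0 < γ) (hc : 0 < c) (hr : 0 < r)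
    {E : Set (EuclideanSpace ℝ (Fin n))} (hE : IsCompact E) (hne : E.Nonempty)
    {f : EuclideanSpace ℝ (Fin n) → EuclideanSpace ℝ (Fin m)} (hf : Continuous f)
    (hol : ∀ x ∈ E, ∀ y ∈ E, ‖f x - f y‖ ≤ c * ‖x - y‖ ^ γ) {K : ℕ}
    (hK : ∀ x ∈ E, ∀ y ∈ E, ‖f x - f y‖ ≤ 2 ^ K * (c * r ^ γ)) :
    (boxCount (2 * (c * r ^ γ)) (f '' E) : ℝ≥0∞) ≤
      ENNReal.ofReal (2 * (8 ^ m * (K + 1))) * capacity (m * γ) r E := by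
  set δ := c * r ^ γ with hδdef
  have hδ : 0 < δ := by positivity
  obtain ⟨T, hTA, hsep, hcov⟩ :=
    exists_finset_separated_cover (hE.image hf).totallyBounded hδ
  obtain ⟨μ, hμ, hμE, hpot⟩ :=
    exists_measure_potential_ge (s := m * γ) (r := r) hE.isClosed hne
  have hae : ∀ᵐ x ∂μ, x ∈ E := hμE
  have hcard : (T.card : ℝ≥0∞) * ((capacity (m * γ) r E)⁻¹ / 2) ≤
      ENNReal.ofReal (8 ^ m * (K + 1)) := by
    calc (T.card : ℝ≥0∞) * ((capacity (m * γ) r E)⁻¹ / 2)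
        = ∑ z ∈ T, (capacity (m * γ) r E)⁻¹ / 2 := by rw [Finset.sum_const, nsmul_eq_mul]
      _ ≤ ∑ z ∈ T, ∫⁻ y, ENNReal.ofReal (kernel m δ (z - f y)) ∂μ := by
          refine Finset.sum_le_sum fun z hz => ?_
          obtain ⟨x, hx, rfl⟩ := hTA hz
          refine (hpot x hx).trans (lintegral_mono_ae ?_)
          filter_upwards [hae] with y hy
          exact ENNReal.ofReal_le_ofReal
            (kernel_le_kernel_of_holder hγ (Nat.cast_nonneg m) hr.le (hol x hx y hy))
      _ = ∫⁻ y, ∑ z ∈ T, ENNReal.ofReal (kernel m δ (z - f y)) ∂μ := by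
          have := hf.measurable
          rw [lintegral_finsetSum]
          intro z _
          fun_prop
      _ ≤ ∫⁻ _, ENNReal.ofReal (8 ^ m * (K + 1)) ∂μ := by
          refine lintegral_mono_ae ?_
          filter_upwards [hae] with y hy
          rw [← ENNReal.ofReal_sum_of_nonneg fun z _ => kernel_nonneg hδ.le _]
          refine ENNReal.ofReal_le_ofReal (sum_kernel_le hδ (fun z hz => ?_) hsep)
          obtain ⟨x, hx, rfl⟩ := hTA hz
          rw [dist_eq_norm]
          exact hK x hx y hy
      _ = _ := by simp
  have hbox : (boxCount (2 * δ) (f '' E) : ℝ≥0∞) ≤ T.card := by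
    exact_mod_cast boxCount_le_card hcov
  refine hbox.trans ?_
  have hB : ENNReal.ofReal (8 ^ m * (K + 1)) ≠ 0 :=
    (ENNReal.ofReal_pos.2 (by positivity)).ne'
  calc (T.card : ℝ≥0∞) ≤ ENNReal.ofReal (8 ^ m * (K + 1)) / ((capacity (m * γ) r E)⁻¹ / 2) :=
        (ENNReal.le_div_iff_mul_le (Or.inr hB) (Or.inr ENNReal.ofReal_ne_top)).2 hcard
    _ = _ := by
        rw [ENNReal.ofReal_mul two_pos.le, div_eq_mul_inv, ENNReal.inv_div (by simp) (by simp),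
          div_eq_mul_inv, inv_inv, ENNReal.ofReal_ofNat]
        ring

end BoxProfile

/-! ### Hölder continuity from moment bounds -/

namespace BoxProfile

variable {n : ℕ}

lemma norm_le_sqrt_mul {v : EuclideanSpace ℝ (Fin n)} {b : ℝ} (hb : 0 ≤ b)
    (h : ∀ i, |v i| ≤ b) : ‖v‖ ≤ √n * b := by
  rw [EuclideanSpace.norm_eq, ← Real.sqrt_sq hb, ← Real.sqrt_mul (Nat.cast_nonneg n)]
  refine Real.sqrt_le_sqrt ?_
  calc ∑ i, ‖v i‖ ^ 2 ≤ ∑ _i : Fin n, b ^ 2 := by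
        refine Finset.sum_le_sum fun i _ => ?_
        rw [Real.norm_eq_abs]
        exact pow_le_pow_left₀ (abs_nonneg _) (h i) 2
    _ = n * b ^ 2 := by simp

/-- The point of the dyadic lattice `2 ^ (-k) ℤⁿ` with integer coordinates `a`. -/
noncomputable def latticePoint (k : ℕ) (a : Fin n → ℤ) : EuclideanSpace ℝ (Fin n) :=
  WithLp.toLp 2 fun i => (a i : ℝ) / 2 ^ k

@[simp] lemma latticePoint_apply (k : ℕ) (a : Fin n → ℤ) (i : Fin n) :
    latticePoint k a i = (a i : ℝ) / 2 ^ k := rfl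

/-- The coordinates of the lower corner of the dyadic cube of level `k` containing `x`. -/
noncomputable def floorIndex (k : ℕ) (x : EuclideanSpace ℝ (Fin n)) (i : Fin n) : ℤ :=
  ⌊2 ^ k * x i⌋

/-- Integer vectors with coordinates of absolute value at most `R 2 ^ k`. -/
noncomputable def latticeBox (n R k : ℕ) : Finset (Fin n → ℤ) :=
  Fintype.piFinset fun _ => Finset.Icc (-(R * 2 ^ k : ℤ)) (R * 2 ^ k)

/-- The steps between neighbouring lattice points, diagonal ones included. -/
noncomputable def latticeSteps (n : ℕ) : Finset (Fin n → ℤ) :=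
  Fintype.piFinset fun _ => Finset.Icc (-1) 1

lemma card_latticeBox_le (R k : ℕ) :
    (latticeBox n R k).card ≤ ((2 * R + 1) * 2 ^ k) ^ n := by
  rw [latticeBox, Fintype.card_piFinset_const, Int.card_Icc]
  refine Nat.pow_le_pow_left ?_ _
  have h : ((R * 2 ^ k + 1 - -(R * 2 ^ k) : ℤ)).toNat = 2 * (R * 2 ^ k) + 1 := by
    have : (R * 2 ^ k + 1 - -(R * 2 ^ k) : ℤ) = ((2 * (R * 2 ^ k) + 1 : ℕ) : ℤ) := by
      push_cast; ring
    rw [this, Int.toNat_natCast]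
  rw [h]
  nlinarith [Nat.one_le_two_pow (n := k)]

lemma card_latticeSteps : (latticeSteps n).card = 3 ^ n := by
  rw [latticeSteps, Fintype.card_piFinset_const]; rfl

lemma mem_latticeSteps {e : Fin n → ℤ} : e ∈ latticeSteps n ↔ ∀ i, |e i| ≤ 1 := by
  simp [latticeSteps, abs_le]

lemma floorIndex_mem_latticeBox {x : EuclideanSpace ℝ (Fin n)} {R : ℕ} (hx : ‖x‖ ≤ R) (k : ℕ) :
    floorIndex k x ∈ latticeBox n R k := by
  simp only [latticeBox, Fintype.mem_piFinset, Finset.mem_Icc]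
  intro i
  have hi := abs_le.1 ((PiLp.norm_apply_le x i).trans hx)
  have h2 : (0 : ℝ) < 2 ^ k := by positivity
  constructor
  · rw [floorIndex, Int.le_floor]
    push_cast
    nlinarith [hi.1]
  · have : (floorIndex k x i : ℝ) ≤ R * 2 ^ k := (Int.floor_le _).trans (by nlinarith [hi.2])
    exact_mod_cast this

lemma norm_latticePoint_add_sub_le {e : Fin n → ℤ} (he : e ∈ latticeSteps n) (k : ℕ)
    (a : Fin n → ℤ) : ‖latticePoint k (a + e) - latticePoint k a‖ ≤ √n / 2 ^ k := by
  rw [div_eq_mul_inv]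
  refine norm_le_sqrt_mul (by positivity) fun i => ?_
  have h : (|e i| : ℝ) ≤ 1 := by exact_mod_cast mem_latticeSteps.1 he i
  simp only [PiLp.sub_apply, latticePoint_apply, Pi.add_apply, Int.cast_add]
  rw [← sub_div, add_sub_cancel_left, abs_div, abs_of_pos (by positivity : (0 : ℝ) < 2 ^ k),
    div_eq_mul_inv]
  exact mul_le_of_le_one_left (by positivity) h

lemma tendsto_latticePoint_floorIndex (x : EuclideanSpace ℝ (Fin n)) :
    Tendsto (fun k => latticePoint k (floorIndex k x)) atTop (𝓝 x) := by
  rw [tendsto_iff_norm_sub_tendsto_zero]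
  have hlim : Tendsto (fun k : ℕ => √n * ((2 : ℝ) ^ k)⁻¹) atTop (𝓝 0) := by
    have := (tendsto_pow_atTop_nhds_zero_of_lt_one (r := (2 : ℝ)⁻¹) (by norm_num)
      (by norm_num)).const_mul √n
    simpa [inv_pow] using this
  refine squeeze_zero (fun _ => norm_nonneg _) (fun k => norm_le_sqrt_mul (by positivity) ?_) hlim
  intro i
  have h2 : (0 : ℝ) < 2 ^ k := by positivity
  have h : |(⌊2 ^ k * x i⌋ : ℝ) - 2 ^ k * x i| ≤ 1 := by
    rw [abs_le]
    constructor <;> linarith [Int.floor_le (2 ^ k * x i), Int.lt_floor_add_one (2 ^ k * x i)]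
  have heq : (latticePoint k (floorIndex k x) - x) i =
      ((⌊2 ^ k * x i⌋ : ℝ) - 2 ^ k * x i) * (2 ^ k)⁻¹ := by
    simp only [PiLp.sub_apply, latticePoint_apply, floorIndex]
    field_simp
  rw [heq, abs_mul, abs_of_pos (inv_pos.2 h2)]
  exact mul_le_of_le_one_left (by positivity) h

/-- Chaining along dyadic approximations: bounds on the increments between neighbouring lattice
points of all levels give a bound on all increments. -/
lemma norm_sub_le_of_lattice {m R : ℕ} {M ρ : ℝ} (hM : 0 ≤ M) (hρ0 : 0 ≤ ρ) (hρ1 : ρ < 1)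
    {g : EuclideanSpace ℝ (Fin n) → EuclideanSpace ℝ (Fin m)} (hg : Continuous g)
    (h : ∀ k, ∀ a ∈ latticeBox n R k, ∀ e ∈ latticeSteps n,
      ‖g (latticePoint k (a + e)) - g (latticePoint k a)‖ ≤ M * ρ ^ k)
    {x y : EuclideanSpace ℝ (Fin n)} (hx : ‖x‖ ≤ R) (hy : ‖y‖ ≤ R) {k : ℕ}
    (hxy : ‖x - y‖ ≤ (2⁻¹ : ℝ) ^ k) :
    ‖g x - g y‖ ≤ M * (1 + 2 / (1 - ρ)) * ρ ^ k := by
  have approx : ∀ z : EuclideanSpace ℝ (Fin n), ‖z‖ ≤ R →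
      dist (g (latticePoint k (floorIndex k z))) (g z) ≤ M * ρ ^ k / (1 - ρ) := by
    intro z hz
    refine dist_le_of_le_geometric_of_tendsto (f := fun j => g (latticePoint j (floorIndex j z)))
      ρ M hρ1 (fun j => ?_)
      ((hg.tendsto z).comp (tendsto_latticePoint_floorIndex z)) k
    -- The approximation of level `j` is also a lattice point of level `j + 1`.
    have hdouble : latticePoint j (floorIndex j z) =
        latticePoint (j + 1) (fun i => 2 * floorIndex j z i) := by
      ext i
      simp only [latticePoint_apply, Int.cast_mul, Int.cast_ofNat, pow_succ]
      field_simp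
    have hbox : (fun i => 2 * floorIndex j z i) ∈ latticeBox n R (j + 1) := by
      have := floorIndex_mem_latticeBox hz j
      simp only [latticeBox, Fintype.mem_piFinset, Finset.mem_Icc, pow_succ] at this ⊢
      intro i
      have := this i
      constructor <;> linarith [this.1, this.2]
    have hstep : floorIndex (j + 1) z - (fun i => 2 * floorIndex j z i) ∈ latticeSteps n := by
      refine mem_latticeSteps.2 fun i => ?_
      have e1 := Int.floor_le (2 ^ j * z i)
      have e2 := Int.lt_floor_add_one (2 ^ j * z i)
      have e3 := Int.floor_le (2 ^ (j + 1) * z i)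
      have e4 := Int.lt_floor_add_one (2 ^ (j + 1) * z i)
      rw [pow_succ] at e3 e4
      have h1 : (floorIndex (j + 1) z i : ℝ) - 2 * floorIndex j z i < 2 := by
        simp only [floorIndex, pow_succ]; linarith
      have h2 : -1 < (floorIndex (j + 1) z i : ℝ) - 2 * floorIndex j z i := by
        simp only [floorIndex, pow_succ]; linarith
      have h1' : floorIndex (j + 1) z i - 2 * floorIndex j z i < 2 := by exact_mod_cast h1
      have h2' : -1 < floorIndex (j + 1) z i - 2 * floorIndex j z i := by exact_mod_cast h2
      simp only [Pi.sub_apply]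
      rw [abs_le]; constructor <;> linarith
    have := h (j + 1) _ hbox _ hstep
    rw [add_sub_cancel, ← hdouble, ← dist_eq_norm, dist_comm] at this
    refine this.trans ?_
    rw [pow_succ]
    exact mul_le_mul_of_nonneg_left (mul_le_of_le_one_right (by positivity) hρ1.le) hM
  have hstep : floorIndex k x - floorIndex k y ∈ latticeSteps n := by
    refine mem_latticeSteps.2 fun i => ?_
    have h2 : (0 : ℝ) < 2 ^ k := by positivity
    have hi : |x i - y i| ≤ (2⁻¹ : ℝ) ^ k := (PiLp.norm_apply_le (x - y) i).trans hxy
    rw [inv_pow, abs_le] at hi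
    have u1 : 2 ^ k * (x i - y i) ≤ 1 := by
      have := mul_le_mul_of_nonneg_left hi.2 h2.le
      rwa [mul_inv_cancel₀ h2.ne'] at this
    have u2 : -1 ≤ 2 ^ k * (x i - y i) := by
      have := mul_le_mul_of_nonneg_left hi.1 h2.le
      rwa [mul_neg, mul_inv_cancel₀ h2.ne'] at this
    have e1 := Int.floor_le (2 ^ k * x i)
    have e2 := Int.lt_floor_add_one (2 ^ k * x i)
    have e3 := Int.floor_le (2 ^ k * y i)
    have e4 := Int.lt_floor_add_one (2 ^ k * y i)
    have h1 : (floorIndex k x i : ℝ) - floorIndex k y i < 2 := by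
      simp only [floorIndex]; linarith
    have h2 : -2 < (floorIndex k x i : ℝ) - floorIndex k y i := by
      simp only [floorIndex]; linarith
    have h1' : floorIndex k x i - floorIndex k y i < 2 := by exact_mod_cast h1
    have h2' : -2 < floorIndex k x i - floorIndex k y i := by exact_mod_cast h2
    simp only [Pi.sub_apply]
    rw [abs_le]; constructor <;> linarith
  have hmid := h k _ (floorIndex_mem_latticeBox hy k) _ hstep
  rw [add_sub_cancel, ← dist_eq_norm] at hmid
  have h1 := approx x hx
  have h2 := approx y hy
  rw [dist_comm] at h1
  rw [← dist_eq_norm]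
  calc dist (g x) (g y) ≤ _ := dist_triangle4 _ _ _ _
    _ ≤ _ := add_le_add (add_le_add h1 hmid) h2
    _ = _ := by ring

/-- Control of the increments over neighbouring lattice points by `2 ^ (-γ k)` at all levels
implies `γ`-Hölder continuity on bounded sets. -/
lemma exists_holder_of_lattice {m R : ℕ} {M γ : ℝ} (hM : 0 ≤ M) (hγ : 0 < γ)
    {g : EuclideanSpace ℝ (Fin n) → EuclideanSpace ℝ (Fin m)} (hg : Continuous g)
    (h : ∀ k, ∀ a ∈ latticeBox n R k, ∀ e ∈ latticeSteps n,
      ‖g (latticePoint k (a + e)) - g (latticePoint k a)‖ ≤ M * ((2⁻¹ : ℝ) ^ γ) ^ k)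
    {E : Set (EuclideanSpace ℝ (Fin n))} (hE : IsCompact E) (hER : ∀ x ∈ E, ‖x‖ ≤ R) :
    ∃ c : ℝ, 0 < c ∧ ∀ x ∈ E, ∀ y ∈ E, ‖g x - g y‖ ≤ c * ‖x - y‖ ^ γ := by
  set ρ := (2⁻¹ : ℝ) ^ γ with hρ
  have hρ0 : 0 < ρ := by positivity
  have hρ1 : ρ < 1 := Real.rpow_lt_one (by norm_num) (by norm_num) hγ
  obtain ⟨B, hB⟩ := (hE.image hg).isBounded.exists_norm_le
  set A := M * (1 + 2 / (1 - ρ)) with hA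
  have hA0 : 0 ≤ A := by
    have : 0 < 1 - ρ := by linarith
    positivity
  refine ⟨A * ρ⁻¹ + 2 * |B| + 1, by positivity, fun x hx y hy => ?_⟩
  rcases eq_or_lt_of_le (norm_nonneg (x - y)) with h0 | h0
  · rw [sub_eq_zero.1 (norm_eq_zero.1 h0.symm), sub_self, norm_zero]
    positivity
  rcases le_or_gt ‖x - y‖ 1 with h1 | h1
  · obtain ⟨k, hk1, hk2⟩ := exists_nat_pow_near_of_lt_one h0 h1 (y := (2⁻¹ : ℝ))
      (by norm_num) (by norm_num)
    have hρk : ρ ^ k ≤ ρ⁻¹ * ‖x - y‖ ^ γ := by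
      have e : ρ ^ (k + 1) ≤ ‖x - y‖ ^ γ := by
        rw [hρ, ← Real.rpow_natCast, ← Real.rpow_mul (by norm_num), mul_comm,
          Real.rpow_mul (by norm_num), Real.rpow_natCast]
        exact Real.rpow_le_rpow (by positivity) hk1.le hγ.le
      rw [pow_succ] at e
      rw [inv_mul_eq_div, le_div_iff₀ hρ0]
      exact e
    calc ‖g x - g y‖ ≤ A * ρ ^ k :=
          norm_sub_le_of_lattice hM hρ0.le hρ1 hg h (hER x hx) (hER y hy) hk2
      _ ≤ A * (ρ⁻¹ * ‖x - y‖ ^ γ) := by gcongr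
      _ = A * ρ⁻¹ * ‖x - y‖ ^ γ := by ring
      _ ≤ _ := by
          gcongr
          have := abs_nonneg B
          linarith
  · have e : 1 ≤ ‖x - y‖ ^ γ := Real.one_le_rpow h1.le hγ.le
    have b1 := hB _ (Set.mem_image_of_mem g hx)
    have b2 := hB _ (Set.mem_image_of_mem g hy)
    have b3 := le_abs_self B
    have b4 : 0 ≤ A * ρ⁻¹ := by positivity
    calc ‖g x - g y‖ ≤ ‖g x‖ + ‖g y‖ := norm_sub_le _ _
      _ ≤ (A * ρ⁻¹ + 2 * |B| + 1) * 1 := by linarith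
      _ ≤ _ := by gcongr

variable {Ω : Type*} [MeasurableSpace Ω] {P : Measure Ω} {m : ℕ}

/-- Kolmogorov's continuity criterion, quantitative part: a process with continuous paths whose
increments have `p`-th moments of order `|x - y| ^ (α p)` for all `p` is almost surely `γ`-Hölder on
compact sets for every `γ < α`. -/
lemma ae_exists_holder {Y : EuclideanSpace ℝ (Fin n) → Ω → EuclideanSpace ℝ (Fin m)}
    (hmeas : ∀ x, Measurable (Y x)) (hcont : ∀ᵐ ω ∂P, Continuous fun x => Y x ω) {α γ : ℝ}
    (hγ : 0 < γ) (hγα : γ < α)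
    (hmom : ∀ p : ℕ, ∃ C : ℝ≥0, ∀ x y,
      ∫⁻ ω, ‖Y x ω - Y y ω‖ₑ ^ p ∂P ≤ C * ENNReal.ofReal (‖x - y‖ ^ (α * p)))
    {E : Set (EuclideanSpace ℝ (Fin n))} (hE : IsCompact E) :
    ∀ᵐ ω ∂P, ∃ c : ℝ, 0 < c ∧ ∀ x ∈ E, ∀ y ∈ E, ‖Y x ω - Y y ω‖ ≤ c * ‖x - y‖ ^ γ := by
  obtain ⟨R₀, hR₀⟩ := hE.isBounded.exists_norm_le
  obtain ⟨R, hR⟩ := exists_nat_ge R₀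
  -- The moment order `p` beats the number `2 ^ (n k)` of lattice points.
  obtain ⟨p, hp⟩ := exists_nat_gt ((n + 1) / (α - γ))
  have hp' : (n : ℝ) + 1 < p * (α - γ) := (div_lt_iff₀ (by linarith)).1 hp
  have hp0 : p ≠ 0 := by
    rintro rfl
    have : (0 : ℝ) ≤ n := Nat.cast_nonneg n
    norm_num at hp'; linarith
  obtain ⟨C, hC⟩ := hmom p
  set D : ℝ≥0∞ := ENNReal.ofReal (((2 * R + 1) ^ n * 3 ^ n) * (C * (√n) ^ (α * p))) with hD
  let F : ℕ → Ω → ℝ≥0∞ := fun k ω => ∑ a ∈ latticeBox n R k, ∑ e ∈ latticeSteps n,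
    ENNReal.ofReal ((2 : ℝ) ^ (γ * p * k)) *
      ‖Y (latticePoint k (a + e)) ω - Y (latticePoint k a) ω‖ₑ ^ p
  have hFm : ∀ k, Measurable (F k) := by
    intro k
    refine Finset.measurable_sum _ fun a _ => Finset.measurable_sum _ fun e _ => ?_
    have := hmeas (latticePoint k (a + e))
    have := hmeas (latticePoint k a)
    fun_prop
  have hF : ∀ k, ∫⁻ ω, F k ω ∂P ≤ D * (2⁻¹ : ℝ≥0∞) ^ k := by
    intro k
    have hterm : ∀ a ∈ latticeBox n R k, ∀ e ∈ latticeSteps n,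
        ∫⁻ ω, ENNReal.ofReal ((2 : ℝ) ^ (γ * p * k)) *
          ‖Y (latticePoint k (a + e)) ω - Y (latticePoint k a) ω‖ₑ ^ p ∂P ≤
        ENNReal.ofReal ((2 : ℝ) ^ (γ * p * k) * (C * (√n / 2 ^ k) ^ (α * p))) := by
      intro a _ e he
      rw [lintegral_const_mul' _ _ ENNReal.ofReal_ne_top, ENNReal.ofReal_mul (by positivity)]
      gcongr
      refine (hC _ _).trans ?_
      rw [ENNReal.ofReal_mul C.coe_nonneg, ENNReal.ofReal_coe_nnreal]
      gcongr
      · exact mul_nonneg (hγ.trans hγα).le (Nat.cast_nonneg p)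
      · exact norm_latticePoint_add_sub_le he k a
    calc ∫⁻ ω, F k ω ∂P = ∑ a ∈ latticeBox n R k, ∑ e ∈ latticeSteps n,
          ∫⁻ ω, ENNReal.ofReal ((2 : ℝ) ^ (γ * p * k)) *
            ‖Y (latticePoint k (a + e)) ω - Y (latticePoint k a) ω‖ₑ ^ p ∂P := by
          have hm' : ∀ a e, Measurable fun ω => ENNReal.ofReal ((2 : ℝ) ^ (γ * p * k)) *
              ‖Y (latticePoint k (a + e)) ω - Y (latticePoint k a) ω‖ₑ ^ p := by
            intro a e
            have := hmeas (latticePoint k (a + e))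
            have := hmeas (latticePoint k a)
            fun_prop
          rw [lintegral_finsetSum _ fun a _ => Finset.measurable_sum _ fun e _ => hm' a e]
          refine Finset.sum_congr rfl fun a _ => ?_
          rw [lintegral_finsetSum _ fun e _ => hm' a e]
      _ ≤ ∑ a ∈ latticeBox n R k, ∑ e ∈ latticeSteps n,
            ENNReal.ofReal ((2 : ℝ) ^ (γ * p * k) * (C * (√n / 2 ^ k) ^ (α * p))) :=
          Finset.sum_le_sum fun a ha => Finset.sum_le_sum fun e he => hterm a ha e he
      _ = ENNReal.ofReal ((latticeBox n R k).card * (3 ^ n * ((2 : ℝ) ^ (γ * p * k) *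
            (C * (√n / 2 ^ k) ^ (α * p))))) := by
          rw [Finset.sum_const, Finset.sum_const, card_latticeSteps, nsmul_eq_mul, nsmul_eq_mul,
            ← ENNReal.ofReal_natCast, ← ENNReal.ofReal_natCast,
            ← ENNReal.ofReal_mul (by positivity), ← ENNReal.ofReal_mul (by positivity)]
          push_cast; rfl
      _ ≤ ENNReal.ofReal (((2 * R + 1) ^ n * 3 ^ n) * (C * (√n) ^ (α * p)) * (2⁻¹) ^ k) := by
          refine ENNReal.ofReal_le_ofReal ?_
          have hcard : ((latticeBox n R k).card : ℝ) ≤ ((2 * R + 1) * 2 ^ k) ^ n := by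
            exact_mod_cast card_latticeBox_le R k
          have hpow : (2 : ℝ) ^ (n * k : ℝ) * 2 ^ (γ * p * k) * (2 ^ (k * (α * p)))⁻¹ ≤
              (2⁻¹) ^ k := by
            rw [← Real.rpow_natCast 2⁻¹, Real.inv_rpow two_pos.le, ← Real.rpow_neg two_pos.le,
              ← Real.rpow_neg two_pos.le, ← Real.rpow_add two_pos, ← Real.rpow_add two_pos]
            refine Real.rpow_le_rpow_of_exponent_le one_le_two ?_
            have : (0 : ℝ) ≤ k := Nat.cast_nonneg k
            nlinarith
          calc _ ≤ ((2 * R + 1) * 2 ^ k : ℝ) ^ n * (3 ^ n * ((2 : ℝ) ^ (γ * p * k) *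
                (C * (√n / 2 ^ k) ^ (α * p)))) := by gcongr
            _ = ((2 * R + 1) ^ n * 3 ^ n) * (C * (√n) ^ (α * p)) *
                ((2 : ℝ) ^ (n * k : ℝ) * 2 ^ (γ * p * k) * (2 ^ (k * (α * p)))⁻¹) := by
                rw [Real.div_rpow (by positivity) (by positivity), ← Real.rpow_natCast 2 k,
                  ← Real.rpow_mul two_pos.le, mul_pow, ← Real.rpow_natCast (2 ^ (k : ℝ)) n,
                  ← Real.rpow_mul two_pos.le, mul_comm (k : ℝ) n]
                ring
            _ ≤ _ := by gcongr
      _ = D * (2⁻¹ : ℝ≥0∞) ^ k := by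
          rw [ENNReal.ofReal_mul (by positivity), ENNReal.ofReal_pow (by norm_num),
            ENNReal.ofReal_inv_of_pos two_pos, ENNReal.ofReal_ofNat]
  have hfin : ∫⁻ ω, ∑' k, F k ω ∂P ≠ ⊤ := by
    rw [lintegral_tsum fun k => (hFm k).aemeasurable]
    refine ((ENNReal.tsum_le_tsum hF).trans_lt ?_).ne
    rw [ENNReal.tsum_mul_left, ENNReal.tsum_geometric, ENNReal.one_sub_inv_two, inv_inv]
    exact ENNReal.mul_lt_top ENNReal.ofReal_lt_top (by simp)
  filter_upwards [hcont, ae_lt_top (Measurable.tsum hFm) hfin] with ω hω hS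
  set S := ∑' k, F k ω with hSdef
  refine exists_holder_of_lattice (R := R) (M := S.toReal ^ (p : ℝ)⁻¹) (by positivity) hγ hω ?_ hE
    fun x hx => (hR₀ x hx).trans hR
  intro k a ha e he
  have hle : ENNReal.ofReal ((2 : ℝ) ^ (γ * p * k)) *
      ‖Y (latticePoint k (a + e)) ω - Y (latticePoint k a) ω‖ₑ ^ p ≤ S :=
    ((Finset.single_le_sum (f := fun e => ENNReal.ofReal ((2 : ℝ) ^ (γ * p * k)) *
      ‖Y (latticePoint k (a + e)) ω - Y (latticePoint k a) ω‖ₑ ^ p) (fun _ _ => zero_le) he).trans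
      (Finset.single_le_sum (f := fun a => ∑ e ∈ latticeSteps n,
        ENNReal.ofReal ((2 : ℝ) ^ (γ * p * k)) *
        ‖Y (latticePoint k (a + e)) ω - Y (latticePoint k a) ω‖ₑ ^ p)
        (fun _ _ => zero_le) ha)).trans (ENNReal.le_tsum k)
  generalize Y (latticePoint k (a + e)) ω - Y (latticePoint k a) ω = v at hle ⊢
  rw [← ofReal_norm, ← ENNReal.ofReal_pow (norm_nonneg _), ← ENNReal.ofReal_mul (by positivity),
    ENNReal.ofReal_le_iff_le_toReal hS.ne] at hle
  have hpR : (0 : ℝ) < p := by exact_mod_cast Nat.pos_of_ne_zero hp0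
  have hroot : (2 : ℝ) ^ (γ * k) * ‖v‖ ≤ S.toReal ^ (p : ℝ)⁻¹ := by
    rw [Real.le_rpow_inv_iff_of_pos (by positivity) ENNReal.toReal_nonneg hpR,
      Real.mul_rpow (by positivity) (norm_nonneg _), ← Real.rpow_mul two_pos.le,
      Real.rpow_natCast ‖v‖]
    rwa [show γ * k * p = γ * p * k by ring]
  have h2 : ((2⁻¹ : ℝ) ^ γ) ^ k = ((2 : ℝ) ^ (γ * k))⁻¹ := by
    rw [← Real.rpow_natCast, ← Real.rpow_mul (by norm_num), Real.inv_rpow two_pos.le]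
  rw [h2, ← div_eq_mul_inv, le_div_iff₀ (by positivity), mul_comm]
  exact hroot

end BoxProfile

/-! ### Correlation sums and covering numbers -/

namespace BoxProfile

section Correlation

variable {n m : ℕ}

/-- The correlation integral: the probability that two independent `μ`-distributed points have
images under `g` at distance at most `r`. -/
noncomputable def correlation (r : ℝ)
    (g : EuclideanSpace ℝ (Fin n) → EuclideanSpace ℝ (Fin m))
    (μ : Measure (EuclideanSpace ℝ (Fin n))) : ℝ≥0∞ :=
  (μ.prod μ) {p | ‖g p.1 - g p.2‖ ≤ r}

/-- Cauchy–Schwarz: if the image of `E` is covered by `k` sets of diameter at most `r`, two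
independent points fall into the same set with probability at least `1 / k`. -/
lemma inv_correlation_le_boxCount {E : Set (EuclideanSpace ℝ (Fin n))}
    {μ : Measure (EuclideanSpace ℝ (Fin n))} [IsProbabilityMeasure μ] (hμ : μ Eᶜ = 0)
    {g : EuclideanSpace ℝ (Fin n) → EuclideanSpace ℝ (Fin m)} (hg : Continuous g)
    {r : ℝ} (hr : 0 ≤ r) :
    (correlation r g μ)⁻¹ ≤ (boxCount r (g '' E) : ℝ≥0∞) := by
  rcases eq_or_ne (boxCount r (g '' E)) ⊤ with htop | htop
  · simp [htop]
  obtain ⟨k, hk⟩ := iInf_lt_iff.1 ((ENat.lt_add_one_iff htop).2 le_rfl)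
  obtain ⟨⟨U, hU, hcov⟩, hk⟩ := iInf_lt_iff.1 hk
  have hk' : ((k : ℕ∞) : ℝ≥0∞) ≤ (boxCount r (g '' E) : ℝ≥0∞) :=
    ENat.toENNReal_le.2 ((ENat.lt_add_one_iff htop).1 hk)
  refine le_trans ?_ hk'
  let V : Fin k → Set (EuclideanSpace ℝ (Fin n)) := fun i => g ⁻¹' closure (U i)
  have hV : ∀ i, MeasurableSet (V i) := fun i => hg.measurable isClosed_closure.measurableSet
  let W := disjointed V
  have hW : ∀ i, MeasurableSet (W i) := fun i => by
    rw [show W i = V i \ (Finset.Iio i).sup V from disjointed_apply V i, Finset.sup_eq_iSup]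
    exact (hV i).diff (Finset.measurableSet_biUnion _ fun j _ => hV j)
  have hdisj : Pairwise (Function.onFun Disjoint W) := disjoint_disjointed V
  have hEW : E ⊆ ⋃ i, W i := by
    rw [iUnion_disjointed]
    intro x hx
    obtain ⟨i, hi⟩ := Set.mem_iUnion.1 (hcov (Set.mem_image_of_mem g hx))
    exact Set.mem_iUnion.2 ⟨i, subset_closure hi⟩
  have hone : 1 ≤ ∑ i, μ.real (W i) := by
    rw [← measureReal_iUnion_fintype hdisj hW]
    have hae : μ (⋃ i, W i)ᶜ = 0 := measure_mono_null (Set.compl_subset_compl.2 hEW) hμ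
    have : μ (⋃ i, W i) = 1 := (prob_compl_eq_zero_iff (MeasurableSet.iUnion hW)).1 hae
    simp [measureReal_def, this]
  have hcs : 1 ≤ (k : ℝ) * ∑ i, μ.real (W i) ^ 2 := by
    have := sq_sum_le_card_mul_sum_sq (s := Finset.univ) (f := fun i => μ.real (W i))
    rw [Finset.card_univ, Fintype.card_fin] at this
    nlinarith
  have hcor : ENNReal.ofReal (∑ i, μ.real (W i) ^ 2) ≤ correlation r g μ := by
    calc ENNReal.ofReal (∑ i, μ.real (W i) ^ 2) = ∑ i, μ (W i) * μ (W i) := by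
          rw [ENNReal.ofReal_sum_of_nonneg fun i _ => by positivity]
          refine Finset.sum_congr rfl fun i _ => ?_
          rw [sq, ENNReal.ofReal_mul measureReal_nonneg, ofReal_measureReal]
      _ = ∑ i, (μ.prod μ) (W i ×ˢ W i) := by simp only [Measure.prod_prod]
      _ = (μ.prod μ) (⋃ i, W i ×ˢ W i) := by
          rw [measure_iUnion (fun i j hij => ?_) fun i => (hW i).prod (hW i), tsum_fintype]
          exact Set.disjoint_prod.2 (Or.inl (hdisj hij))
      _ ≤ correlation r g μ := by
          refine measure_mono (Set.iUnion_subset fun i p hp => ?_)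
          have h1 : g p.1 ∈ closure (U i) := disjointed_subset V i hp.1
          have h2 : g p.2 ∈ closure (U i) := disjointed_subset V i hp.2
          have h3 := (Metric.edist_le_ediam_of_mem h1 h2).trans
            ((Metric.ediam_closure _).trans_le (hU i))
          rw [edist_dist, ENNReal.ofReal_le_ofReal_iff hr, dist_eq_norm] at h3
          exact h3
  rw [ENat.toENNReal_coe, ← one_div]
  refine ENNReal.div_le_of_le_mul ?_
  calc (1 : ℝ≥0∞) = ENNReal.ofReal 1 := by simp
    _ ≤ ENNReal.ofReal (k * ∑ i, μ.real (W i) ^ 2) := ENNReal.ofReal_le_ofReal hcs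
    _ = k * ENNReal.ofReal (∑ i, μ.real (W i) ^ 2) := by
        rw [ENNReal.ofReal_mul (Nat.cast_nonneg k), ENNReal.ofReal_natCast]
    _ ≤ _ := by gcongr

variable {Ω : Type*} [MeasurableSpace Ω] {P : Measure Ω} [SFinite P]
  {Y : EuclideanSpace ℝ (Fin n) → Ω → EuclideanSpace ℝ (Fin m)}

lemma measurableSet_norm_sub_le (hmeas : ∀ x, Measurable (Y x))
    (hcont : ∀ ω, Continuous fun x => Y x ω) (r : ℝ) :
    MeasurableSet {q : Ω × (EuclideanSpace ℝ (Fin n) × EuclideanSpace ℝ (Fin n)) |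
      ‖Y q.2.1 q.1 - Y q.2.2 q.1‖ ≤ r} := by
  have hY : Measurable (Function.uncurry Y) :=
    measurable_uncurry_of_continuous_of_measurable hcont hmeas
  have h1 : Measurable fun q : Ω × (EuclideanSpace ℝ (Fin n) × EuclideanSpace ℝ (Fin n)) =>
      Y q.2.1 q.1 := hY.comp (f := fun q : Ω × (EuclideanSpace ℝ (Fin n) ×
        EuclideanSpace ℝ (Fin n)) => (q.2.1, q.1)) (by fun_prop)
  have h2 : Measurable fun q : Ω × (EuclideanSpace ℝ (Fin n) × EuclideanSpace ℝ (Fin n)) =>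
      Y q.2.2 q.1 := hY.comp (f := fun q : Ω × (EuclideanSpace ℝ (Fin n) ×
        EuclideanSpace ℝ (Fin n)) => (q.2.2, q.1)) (by fun_prop)
  exact measurableSet_le (h1.sub h2).norm measurable_const

lemma measurable_correlation (hmeas : ∀ x, Measurable (Y x))
    (hcont : ∀ ω, Continuous fun x => Y x ω) (r : ℝ)
    (μ : Measure (EuclideanSpace ℝ (Fin n))) [SFinite μ] :
    Measurable fun ω => correlation r (fun x => Y x ω) μ :=
  measurable_measure_prodMk_left (measurableSet_norm_sub_le hmeas hcont r)

/-- If the increments satisfy the small ball estimate given by the kernel, the expected correlation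
integral is at most the energy. -/
lemma lintegral_correlation_le (hmeas : ∀ x, Measurable (Y x))
    (hcont : ∀ ω, Continuous fun x => Y x ω) {r s t : ℝ}
    (h : ∀ x y, P {ω | ‖Y x ω - Y y ω‖ ≤ r} ≤ ENNReal.ofReal (kernel s t (x - y)))
    (μ : Measure (EuclideanSpace ℝ (Fin n))) [SFinite μ] :
    ∫⁻ ω, correlation r (fun x => Y x ω) μ ∂P ≤ energy s t μ := by
  have hA := measurableSet_norm_sub_le hmeas hcont r
  calc ∫⁻ ω, correlation r (fun x => Y x ω) μ ∂P
      = (P.prod (μ.prod μ)) {q : Ω × (EuclideanSpace ℝ (Fin n) × EuclideanSpace ℝ (Fin n)) |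
      ‖Y q.2.1 q.1 - Y q.2.2 q.1‖ ≤ r} := (Measure.prod_apply hA).symm
    _ = ∫⁻ p, P {ω | ‖Y p.1 ω - Y p.2 ω‖ ≤ r} ∂(μ.prod μ) := Measure.prod_apply_symm hA
    _ ≤ ∫⁻ p, ENNReal.ofReal (kernel s t (p.1 - p.2)) ∂(μ.prod μ) :=
        lintegral_mono fun p => h p.1 p.2
    _ = energy s t μ := lintegral_prod_symm _ (by fun_prop)

/-- Almost sure lower bound for covering numbers along the scales `2 ^ (-k)`. Averaging the
correlation integrals of nearly optimal measures over all scales, with weights `(k + 1) ^ (-2)`,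
bounds them simultaneously. -/
lemma ae_capacity_le_boxCount (hmeas : ∀ x, Measurable (Y x))
    (hcont : ∀ ω, Continuous fun x => Y x ω) {s : ℝ} (hs : 0 ≤ s) {t : ℕ → ℝ}
    (ht : ∀ k, 0 < t k)
    (h : ∀ k x y, P {ω | ‖Y x ω - Y y ω‖ ≤ (2⁻¹ : ℝ) ^ k} ≤
      ENNReal.ofReal (kernel s (t k) (x - y)))
    {E : Set (EuclideanSpace ℝ (Fin n))} (hE : IsCompact E) (hne : E.Nonempty) :
    ∀ᵐ ω ∂P, ∃ M : ℝ, 0 < M ∧ ∀ k : ℕ, capacity s (t k) E ≤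
      ENNReal.ofReal (M * (k + 1) ^ 2) *
        (boxCount ((2⁻¹ : ℝ) ^ k) ((fun x => Y x ω) '' E) : ℝ≥0∞) := by
  choose μ hμ hμE henergy using fun k => exists_measure_energy_le hs (ht k) hE hne
  let F : ℕ → Ω → ℝ≥0∞ := fun k ω => ENNReal.ofReal (1 / (k + 1 : ℝ) ^ 2) *
    (capacity s (t k) E * correlation ((2⁻¹ : ℝ) ^ k) (fun x => Y x ω) (μ k))
  have hFm : ∀ k, Measurable (F k) := fun k =>
    ((measurable_correlation hmeas hcont _ (μ k)).const_mul _).const_mul _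
  have hfin : ∫⁻ ω, ∑' k, F k ω ∂P ≠ ⊤ := by
    rw [lintegral_tsum fun k => (hFm k).aemeasurable]
    have hle : ∀ k, ∫⁻ ω, F k ω ∂P ≤ ENNReal.ofReal (1 / (k + 1 : ℝ) ^ 2) * 2 := by
      intro k
      rw [lintegral_const_mul _ ((measurable_correlation hmeas hcont _ (μ k)).const_mul _),
        lintegral_const_mul _ (measurable_correlation hmeas hcont _ (μ k))]
      gcongr
      refine le_trans ?_ (henergy k)
      gcongr
      exact lintegral_correlation_le hmeas hcont (h k) (μ k)
    refine ((ENNReal.tsum_le_tsum hle).trans_lt ?_).ne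
    rw [ENNReal.tsum_mul_right]
    have hsum : Summable fun k : ℕ => 1 / (k + 1 : ℝ) ^ 2 := by
      have := (summable_nat_add_iff 1).2 (Real.summable_one_div_nat_pow.2 (one_lt_two))
      simpa using this
    exact ENNReal.mul_lt_top hsum.tsum_ofReal_ne_top.lt_top (by simp)
  filter_upwards [ae_lt_top (Measurable.tsum hFm) hfin] with ω hS
  set S := ∑' k, F k ω with hSdef
  refine ⟨S.toReal + 1, by positivity, fun k => ?_⟩
  have hk : F k ω ≤ ENNReal.ofReal (S.toReal + 1) := by
    refine (ENNReal.le_tsum (f := fun k => F k ω) k).trans ?_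
    rw [ENNReal.le_ofReal_iff_toReal_le hS.ne (by positivity)]
    linarith
  have hw : ENNReal.ofReal ((k + 1 : ℝ) ^ 2) * ENNReal.ofReal (1 / (k + 1 : ℝ) ^ 2) = 1 := by
    rw [← ENNReal.ofReal_mul (by positivity), mul_one_div_cancel (by positivity),
      ENNReal.ofReal_one]
  have hmul : capacity s (t k) E * correlation ((2⁻¹ : ℝ) ^ k) (fun x => Y x ω) (μ k) ≤
      ENNReal.ofReal ((S.toReal + 1) * (k + 1) ^ 2) := by
    calc _ = ENNReal.ofReal ((k + 1 : ℝ) ^ 2) * F k ω := by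
          rw [← mul_assoc, hw, one_mul]
      _ ≤ ENNReal.ofReal ((k + 1 : ℝ) ^ 2) * ENNReal.ofReal (S.toReal + 1) := by gcongr
      _ = _ := by rw [← ENNReal.ofReal_mul (by positivity), mul_comm]
  have hpos : ENNReal.ofReal ((S.toReal + 1) * (k + 1) ^ 2) ≠ 0 :=
    (ENNReal.ofReal_pos.2 (by positivity)).ne'
  calc capacity s (t k) E
      ≤ ENNReal.ofReal ((S.toReal + 1) * (k + 1) ^ 2) /
          correlation ((2⁻¹ : ℝ) ^ k) (fun x => Y x ω) (μ k) :=
        (ENNReal.le_div_iff_mul_le (Or.inr hpos) (Or.inr ENNReal.ofReal_ne_top)).2 hmul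
    _ ≤ _ := by
        rw [div_eq_mul_inv]
        gcongr
        exact inv_correlation_le_boxCount (hμE k) (hcont ω) (by positivity)

end Correlation

end BoxProfile

/-! ### Increments of fractional Brownian motion -/

namespace BoxProfile

/-- The density of a centred Gaussian of variance `σ ^ 2` is at most `1 / (2 σ)`. -/
lemma gaussianReal_abs_le {σ r : ℝ} (hσ : 0 < σ) :
    gaussianReal 0 (Real.toNNReal (σ ^ 2)) {x | |x| ≤ r} ≤ ENNReal.ofReal (r / σ) := by
  have hv : Real.toNNReal (σ ^ 2) ≠ 0 := by
    rw [Ne, Real.toNNReal_eq_zero, not_le]; positivity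
  rw [gaussianReal_apply _ hv]
  have hpdf : ∀ x, gaussianPDF 0 (Real.toNNReal (σ ^ 2)) x ≤ ENNReal.ofReal (1 / (2 * σ)) := by
    intro x
    refine ENNReal.ofReal_le_ofReal ?_
    rw [gaussianPDFReal_def, Real.coe_toNNReal _ (by positivity)]
    have h1 : Real.exp (-(x - 0) ^ 2 / (2 * σ ^ 2)) ≤ 1 := by
      rw [Real.exp_le_one_iff, neg_div]
      exact neg_nonpos.2 (by positivity)
    have h2 : 2 * σ ≤ √(2 * Real.pi * σ ^ 2) := by
      refine Real.le_sqrt_of_sq_le ?_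
      nlinarith [Real.pi_gt_three, sq_nonneg σ]
    have h3 : (√(2 * Real.pi * σ ^ 2))⁻¹ ≤ 1 / (2 * σ) := by
      rw [one_div]
      exact inv_anti₀ (by positivity) h2
    exact (mul_le_of_le_one_right (by positivity) h1).trans h3
  calc ∫⁻ x in {x | |x| ≤ r}, gaussianPDF 0 (Real.toNNReal (σ ^ 2)) x
      ≤ ∫⁻ x in {x | |x| ≤ r}, ENNReal.ofReal (1 / (2 * σ)) := lintegral_mono hpdf
    _ = ENNReal.ofReal (1 / (2 * σ)) * volume (Set.Icc (-r) r) := by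
        rw [lintegral_const, Measure.restrict_apply_univ]
        congr 2
        ext x
        simp [abs_le]
    _ = ENNReal.ofReal (r / σ) := by
        rw [Real.volume_Icc, ← ENNReal.ofReal_mul (by positivity)]
        congr 1
        field_simp
        ring

lemma lintegral_gaussianReal_pow (σ : ℝ) (p : ℕ) :
    ∫⁻ x, ‖x‖ₑ ^ p ∂(gaussianReal 0 (Real.toNNReal (σ ^ 2))) =
      ‖σ‖ₑ ^ p * ∫⁻ x, ‖x‖ₑ ^ p ∂(gaussianReal 0 1) := by
  have h : gaussianReal 0 (Real.toNNReal (σ ^ 2)) = (gaussianReal 0 1).map (σ * ·) := by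
    rw [gaussianReal_map_const_mul, mul_zero, mul_one]
    congr 1
    ext
    simp [sq_nonneg]
  rw [h, lintegral_map (by fun_prop) (by fun_prop)]
  simp_rw [enorm_mul, mul_pow]
  rw [lintegral_const_mul _ (by fun_prop)]

lemma lintegral_gaussianReal_pow_ne_top (p : ℕ) :
    ∫⁻ x, ‖x‖ₑ ^ p ∂(gaussianReal 0 1) ≠ ⊤ := by
  rcases eq_or_ne p 0 with rfl | hp
  · simp
  have h := (memLp_id_gaussianReal (μ := 0) (v := 1) p)
  have h2 := (eLpNorm_lt_top_iff_lintegral_rpow_enorm_lt_top (p := (p : ℝ≥0∞)) (by simpa using hp)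
    (by simp)).1 h.2
  simpa using h2.ne

namespace IsFractionalBrownianMotion

variable {n m : ℕ} {Ω : Type*} [MeasurableSpace Ω] {P : Measure Ω} {α : ℝ}
  {X : EuclideanSpace ℝ (Fin n) → Ω → EuclideanSpace ℝ (Fin m)}

lemma hasLaw_increment (hX : IsFractionalBrownianMotion α X P) (i : Fin m)
    (x y : EuclideanSpace ℝ (Fin n)) :
    HasLaw (fun ω => X x ω i - X y ω i)
      (gaussianReal 0 (Real.toNNReal ((‖x - y‖ ^ α) ^ 2))) P := by
  have h : Real.toNNReal ((‖x - y‖ ^ α) ^ 2) = ‖x - y‖₊ ^ (2 * α) := by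
    ext
    rw [Real.coe_toNNReal _ (by positivity), NNReal.coe_rpow, coe_nnnorm, mul_comm,
      Real.rpow_mul (norm_nonneg _), Real.rpow_two]
  rw [h]
  exact hX.increment i x y

/-- Small ball estimate for the increments: the independent coordinates contribute a factor
`r / |x - y| ^ α` each. -/
lemma measure_norm_sub_le (hX : IsFractionalBrownianMotion α X P) [IsProbabilityMeasure P]
    (hα : 0 < α) {r : ℝ} (hr : 0 < r) (x y : EuclideanSpace ℝ (Fin n)) :
    P {ω | ‖X x ω - X y ω‖ ≤ r} ≤ ENNReal.ofReal (kernel (m * α) (r ^ (1 / α)) (x - y)) := by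
  by_cases hxy : x - y = 0
  · rw [hxy, kernel_zero, ENNReal.ofReal_one]; exact prob_le_one
  have hd : 0 < ‖x - y‖ := norm_pos_iff.2 hxy
  have hker : kernel (m * α) (r ^ (1 / α)) (x - y) = min 1 ((r / ‖x - y‖ ^ α) ^ m) := by
    rw [kernel_of_ne hxy, mul_comm (m : ℝ), Real.rpow_mul (by positivity),
      Real.div_rpow (by positivity) hd.le, ← Real.rpow_mul hr.le, one_div,
      inv_mul_cancel₀ hα.ne', Real.rpow_one, Real.rpow_natCast]
  rw [hker, ENNReal.ofReal_min, ENNReal.ofReal_one]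
  refine le_min prob_le_one ?_
  have hind : iIndepFun (fun (i : Fin m) ω => X x ω i - X y ω i) P :=
    hX.indep.comp (fun _ (f : EuclideanSpace ℝ (Fin n) → ℝ) => f x - f y)
      fun _ => (measurable_pi_apply x).sub (measurable_pi_apply y)
  have hset : MeasurableSet {z : ℝ | |z| ≤ r} := measurableSet_le (by fun_prop) (by fun_prop)
  calc P {ω | ‖X x ω - X y ω‖ ≤ r}
      ≤ P (⋂ i ∈ (Finset.univ : Finset (Fin m)),
          (fun ω => X x ω i - X y ω i) ⁻¹' {z | |z| ≤ r}) := by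
        refine measure_mono fun ω hω => ?_
        simp only [Set.mem_iInter]
        exact fun i _ => (PiLp.norm_apply_le (X x ω - X y ω) i).trans hω
    _ = ∏ i : Fin m, P ((fun ω => X x ω i - X y ω i) ⁻¹' {z | |z| ≤ r}) :=
        hind.measure_inter_preimage_eq_mul Finset.univ fun _ _ => hset
    _ ≤ ∏ _i : Fin m, ENNReal.ofReal (r / ‖x - y‖ ^ α) := by
        refine Finset.prod_le_prod' fun i _ => ?_
        refine ((hX.hasLaw_increment i x y).measure_eq (p := fun z => |z| ≤ r) hset).trans_le ?_
        exact gaussianReal_abs_le (by positivity)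
    _ = ENNReal.ofReal ((r / ‖x - y‖ ^ α) ^ m) := by
        rw [Finset.prod_const, Finset.card_univ, Fintype.card_fin,
          ENNReal.ofReal_pow (by positivity)]

/-- All moments of the increments scale like powers of `|x - y| ^ α`. -/
lemma exists_moment_bound (hX : IsFractionalBrownianMotion α X P) (hm : 0 < m) (p : ℕ) :
    ∃ C : ℝ≥0, ∀ x y : EuclideanSpace ℝ (Fin n),
      ∫⁻ ω, ‖X x ω - X y ω‖ₑ ^ p ∂P ≤ C * ENNReal.ofReal (‖x - y‖ ^ (α * p)) := by
  have : Nonempty (Fin m) := ⟨⟨0, hm⟩⟩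
  set c := ∫⁻ x, ‖x‖ₑ ^ p ∂(gaussianReal 0 1) with hc
  have hctop : c ≠ ⊤ := lintegral_gaussianReal_pow_ne_top p
  have hfin : ENNReal.ofReal (√m ^ p) * (m * c) ≠ ⊤ :=
    ENNReal.mul_ne_top ENNReal.ofReal_ne_top (ENNReal.mul_ne_top (by simp) hctop)
  refine ⟨(ENNReal.ofReal (√m ^ p) * (m * c)).toNNReal, fun x y => ?_⟩
  rw [ENNReal.coe_toNNReal hfin]
  have hpt : ∀ v : EuclideanSpace ℝ (Fin m),
      ‖v‖ₑ ^ p ≤ ENNReal.ofReal (√m ^ p) * ∑ i, ‖v i‖ₑ ^ p := by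
    intro v
    obtain ⟨j, hj⟩ := Finite.exists_max fun i => |v i|
    have h1 : ‖v‖ ^ p ≤ √m ^ p * |v j| ^ p := by
      rw [← mul_pow]
      exact pow_le_pow_left₀ (norm_nonneg _) (norm_le_sqrt_mul (abs_nonneg _) hj) p
    calc ‖v‖ₑ ^ p ≤ ENNReal.ofReal (√m ^ p) * ‖v j‖ₑ ^ p := by
          rw [← ofReal_norm, ← ofReal_norm, ← ENNReal.ofReal_pow (norm_nonneg _),
            ← ENNReal.ofReal_pow (norm_nonneg _), ← ENNReal.ofReal_mul (by positivity)]
          exact ENNReal.ofReal_le_ofReal h1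
      _ ≤ _ := by
          gcongr
          exact Finset.single_le_sum (f := fun i => ‖v i‖ₑ ^ p) (fun _ _ => zero_le)
            (Finset.mem_univ j)
  have hcoord : ∀ i, ∫⁻ ω, ‖X x ω i - X y ω i‖ₑ ^ p ∂P =
      ENNReal.ofReal (‖x - y‖ ^ (α * p)) * c := by
    intro i
    have hl := hX.hasLaw_increment i x y
    have h1 := lintegral_map' (μ := P) (f := fun z : ℝ => ‖z‖ₑ ^ p)
      (g := fun ω => X x ω i - X y ω i) (by fun_prop) hl.aemeasurable
    rw [← h1, hl.map_eq, lintegral_gaussianReal_pow, ← ofReal_norm,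
      ← ENNReal.ofReal_pow (norm_nonneg _), Real.norm_of_nonneg (by positivity),
      Real.rpow_mul (norm_nonneg _), Real.rpow_natCast]
  calc ∫⁻ ω, ‖X x ω - X y ω‖ₑ ^ p ∂P
      ≤ ∫⁻ ω, ENNReal.ofReal (√m ^ p) * ∑ i, ‖X x ω i - X y ω i‖ₑ ^ p ∂P :=
        lintegral_mono fun ω => hpt _
    _ = ENNReal.ofReal (√m ^ p) * ∑ i, ∫⁻ ω, ‖X x ω i - X y ω i‖ₑ ^ p ∂P := by
        rw [lintegral_const_mul' _ _ ENNReal.ofReal_ne_top]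
        congr 1
        refine lintegral_finsetSum' _ fun i _ => ?_
        have := (hX.hasLaw_increment i x y).aemeasurable
        fun_prop
    _ = ENNReal.ofReal (√m ^ p) * (m * c) * ENNReal.ofReal (‖x - y‖ ^ (α * p)) := by
        simp_rw [hcoord]
        rw [Finset.sum_const, Finset.card_univ, Fintype.card_fin, nsmul_eq_mul]
        ring

/-- An indistinguishable version all of whose paths are continuous. -/
lemma exists_continuous_version (hX : IsFractionalBrownianMotion α X P) :
    ∃ Y : EuclideanSpace ℝ (Fin n) → Ω → EuclideanSpace ℝ (Fin m),
      (∀ x, Measurable (Y x)) ∧ (∀ ω, Continuous fun x => Y x ω) ∧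
      ∀ᵐ ω ∂P, ∀ x, Y x ω = X x ω := by
  classical
  obtain ⟨N, hN, hNm, hN0⟩ := exists_measurable_superset_of_null (ae_iff.1 hX.continuous)
  refine ⟨fun x => Nᶜ.indicator (X x), fun x => (hX.measurable x).indicator hNm.compl,
    fun ω => ?_, ?_⟩
  · by_cases hω : ω ∈ N
    · simpa [hω] using continuous_const
    · simpa [hω] using not_not.1 fun h => hω (hN h)
  · filter_upwards [measure_eq_zero_iff_ae_notMem.1 hN0] with ω hω x
    simp [hω]

end IsFractionalBrownianMotion

end BoxProfile

/-! ### Comparison of the two exponents -/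

namespace BoxProfile

lemma eventually_mul_rpow_le_one (c : ℝ) {a : ℝ} (ha : 0 < a) :
    ∀ᶠ r : ℝ in 𝓝[>] 0, c * r ^ a ≤ 1 := by
  have h : Tendsto (fun r : ℝ => r ^ a) (𝓝[>] 0) (𝓝 0) :=
    (map_rpow_nhdsGT_zero ha).le.trans nhdsWithin_le_nhds
  have h' := h.const_mul c
  rw [mul_zero] at h'
  exact h'.eventually_le_const zero_lt_one

lemma eventually_mul_neg_log_add_le (a b : ℝ) {ε : ℝ} (hε : 0 < ε) :
    ∀ᶠ r : ℝ in 𝓝[>] 0, a * (-Real.log r) + b ≤ r ^ (-ε) := by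
  have h := (tendsto_log_mul_rpow_nhdsGT_zero hε).const_mul (-a)
  rw [mul_zero] at h
  filter_upwards [h.eventually_le_const (by norm_num : (0 : ℝ) < 1 / 2),
    eventually_mul_rpow_le_one (2 * b) hε, self_mem_nhdsWithin] with r h1 h2 hr
  have hr0 : (0 : ℝ) < r := hr
  have hp : 0 < r ^ ε := Real.rpow_pos_of_pos hr0 _
  rw [Real.rpow_neg hr0.le, ← one_div, le_div_iff₀ hp]
  linarith

variable {n m : ℕ} {α : ℝ} {E : Set (EuclideanSpace ℝ (Fin n))}
  {f : EuclideanSpace ℝ (Fin n) → EuclideanSpace ℝ (Fin m)}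

lemma exists_holder_of_le (hE : IsCompact E) {γ γ' : ℝ} (hγ : 0 < γ) (hγγ' : γ ≤ γ')
    (h : ∃ c : ℝ, 0 < c ∧ ∀ x ∈ E, ∀ y ∈ E, ‖f x - f y‖ ≤ c * ‖x - y‖ ^ γ') :
    ∃ c : ℝ, 0 < c ∧ ∀ x ∈ E, ∀ y ∈ E, ‖f x - f y‖ ≤ c * ‖x - y‖ ^ γ := by
  obtain ⟨c, hc, h⟩ := h
  have hD : 0 ≤ Metric.diam E := Metric.diam_nonneg
  refine ⟨c * (Metric.diam E + 1) ^ (γ' - γ), by positivity,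
    fun x hx y hy => (h x hx y hy).trans ?_⟩
  have hxy : ‖x - y‖ ≤ Metric.diam E + 1 := by
    rw [← dist_eq_norm]
    exact (Metric.dist_le_diam_of_mem hE.isBounded hx hy).trans (by linarith)
  have e : ‖x - y‖ ^ γ' = ‖x - y‖ ^ (γ' - γ) * ‖x - y‖ ^ γ := by
    rw [← Real.rpow_add_of_nonneg (norm_nonneg _) (by linarith) hγ.le, sub_add_cancel]
  rw [e, ← mul_assoc]
  gcongr

/-- If `f` is `γ`-Hölder on `E` for every `γ < α`, then `N_{r ^ α}(f(E))` is at most the capacity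
`C_r(E)` of exponent `m α`, up to subpolynomial factors. -/
lemma eventually_boxCount_le_capacity (hα : 0 < α) (hE : IsCompact E) (hne : E.Nonempty)
    (hf : Continuous f)
    (hol : ∀ γ : ℝ, 0 < γ → γ < α →
      ∃ c : ℝ, 0 < c ∧ ∀ x ∈ E, ∀ y ∈ E, ‖f x - f y‖ ≤ c * ‖x - y‖ ^ γ)
    {ε : ℝ} (h0 : 0 < ε) (h1 : ε < 1) :
    ∀ᶠ r in 𝓝[>] (0 : ℝ), (boxCount (r ^ (α * (1 - ε))) (f '' E) : ℝ≥0∞) ≤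
      ENNReal.ofReal (r ^ (-ε)) * capacity (m * α) r E := by
  set γ := α * (1 - ε / 2) with hγdef
  have hγ : 0 < γ := mul_pos hα (by linarith)
  have hγα : γ < α := by nlinarith
  obtain ⟨c, hc, hcol⟩ := hol γ hγ hγα
  obtain ⟨B, hB⟩ := (hE.image hf).isBounded.exists_norm_le
  -- With `K` about `L (-log r)`, the ball of radius `2 ^ K c r ^ γ` contains the image.
  set L := 2 * γ / Real.log 2 with hL
  have hlog2 : 0 < Real.log 2 := Real.log_pos one_lt_two
  filter_upwards [eventually_mul_rpow_le_one (2 * c) (by positivity : 0 < α * ε / 2),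
    eventually_mul_rpow_le_one (2 * B / c) hγ,
    eventually_mul_neg_log_add_le (2 * 8 ^ m * L) (2 * 8 ^ m * 2) h0,
    Ioo_mem_nhdsGT (zero_lt_one' ℝ)] with r hr1 hr2 hr3 hr
  have hr0 : 0 < r := hr.1
  have hl : 0 < -Real.log r := by have := Real.log_neg hr.1 hr.2; linarith
  set K := ⌈L * (-Real.log r)⌉₊ with hK
  have hKle : (K : ℝ) + 1 ≤ L * (-Real.log r) + 2 := by
    have := Nat.ceil_lt_add_one (by positivity : 0 ≤ L * (-Real.log r))
    linarith
  have h2K : r ^ (-(2 * γ)) ≤ 2 ^ K := by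
    have h : L * (-Real.log r) ≤ K := Nat.le_ceil _
    rw [← Real.rpow_natCast 2, Real.rpow_def_of_pos hr0, Real.rpow_def_of_pos two_pos]
    refine Real.exp_le_exp.2 ?_
    calc Real.log r * -(2 * γ) = Real.log 2 * (L * (-Real.log r)) := by
          rw [hL]; field_simp
      _ ≤ _ := by gcongr
  have hcov : ∀ x ∈ E, ∀ y ∈ E, ‖f x - f y‖ ≤ 2 ^ K * (c * r ^ γ) := by
    intro x hx y hy
    have b1 := hB _ (Set.mem_image_of_mem f hx)
    have b2 := hB _ (Set.mem_image_of_mem f hy)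
    have hp : 0 < r ^ γ := Real.rpow_pos_of_pos hr0 _
    calc ‖f x - f y‖ ≤ 2 * B := by have := norm_sub_le (f x) (f y); linarith
      _ ≤ c * (r ^ γ)⁻¹ := by
          rw [← div_eq_mul_inv, le_div_iff₀ hp]
          rw [div_mul_eq_mul_div, div_le_one hc] at hr2
          exact hr2
      _ = r ^ (-(2 * γ)) * (c * r ^ γ) := by
          rw [Real.rpow_neg hr0.le, two_mul, Real.rpow_add hr0]
          field_simp
      _ ≤ 2 ^ K * (c * r ^ γ) := by gcongr
  have hrad : 2 * (c * r ^ γ) ≤ r ^ (α * (1 - ε)) := by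
    have e : r ^ γ = r ^ (α * ε / 2) * r ^ (α * (1 - ε)) := by
      rw [← Real.rpow_add hr0, hγdef]; congr 1; ring
    rw [e]
    have hp : 0 < r ^ (α * (1 - ε)) := Real.rpow_pos_of_pos hr0 _
    nlinarith
  calc (boxCount (r ^ (α * (1 - ε))) (f '' E) : ℝ≥0∞)
      ≤ (boxCount (2 * (c * r ^ γ)) (f '' E) : ℝ≥0∞) :=
        ENat.toENNReal_le.2 (boxCount_anti (f '' E) hrad)
    _ ≤ ENNReal.ofReal (2 * (8 ^ m * (K + 1))) * capacity (m * γ) r E :=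
        boxCount_image_le hγ hc hr0 hE hne hf hcol hcov
    _ ≤ ENNReal.ofReal (r ^ (-ε)) * capacity (m * α) r E := by
        refine mul_le_mul' (ENNReal.ofReal_le_ofReal ?_)
          (capacity_mono_exponent hr0 (by positivity) (by gcongr))
        have : (0 : ℝ) < 8 ^ m := by positivity
        nlinarith

/-- A comparison along the scales `2 ^ (-k)`, with polynomial loss in `k`, passes to all scales with
subpolynomial loss. -/
lemma eventually_capacity_le_boxCount (hα : 0 < α) {s : ℝ} (hs : 0 ≤ s)
    {A : Set (EuclideanSpace ℝ (Fin m))} {M : ℝ}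
    (h : ∀ k : ℕ, capacity s (((2⁻¹ : ℝ) ^ k) ^ (1 / α)) E ≤
      ENNReal.ofReal (M * (k + 1) ^ 2) * (boxCount ((2⁻¹ : ℝ) ^ k) A : ℝ≥0∞))
    {ε : ℝ} (h0 : 0 < ε) :
    ∀ᶠ r in 𝓝[>] (0 : ℝ), capacity s (r ^ (1 / α * (1 - ε))) E ≤
      ENNReal.ofReal (r ^ (-ε)) * (boxCount r A : ℝ≥0∞) := by
  have hlog2 : 0 < Real.log 2 := Real.log_pos one_lt_two
  filter_upwards [eventually_mul_rpow_le_one 2 h0,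
    eventually_mul_rpow_le_one M (by positivity : 0 < ε / 2),
    eventually_mul_neg_log_add_le (1 / Real.log 2) 1 (by positivity : 0 < ε / 4),
    Ioo_mem_nhdsGT (zero_lt_one' ℝ)] with r hr1 hr2 hr3 hr
  have hr0 : 0 < r := hr.1
  obtain ⟨k, hk1, hk2⟩ := exists_nat_pow_near_of_lt_one hr0 hr.2.le (y := (2⁻¹ : ℝ))
    (by norm_num) (by norm_num)
  have hkr : (2⁻¹ : ℝ) ^ k ≤ r ^ (1 - ε) := by
    rw [pow_succ] at hk1
    have e : r = r ^ ε * r ^ (1 - ε) := by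
      rw [← Real.rpow_add hr0]; simp
    have hp : 0 < r ^ (1 - ε) := Real.rpow_pos_of_pos hr0 _
    calc (2⁻¹ : ℝ) ^ k ≤ 2 * r := by linarith
      _ = 2 * r ^ ε * r ^ (1 - ε) := by rw [mul_assoc, ← e]
      _ ≤ _ := mul_le_of_le_one_left hp.le hr1
  have hklog : (k : ℝ) + 1 ≤ r ^ (-(ε / 4)) := by
    refine le_trans ?_ hr3
    have := Real.log_le_log hr0 hk2
    rw [Real.log_pow, Real.log_inv] at this
    have h2 : (k : ℝ) ≤ 1 / Real.log 2 * (-Real.log r) := by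
      rw [one_div, inv_mul_eq_div, le_div_iff₀ hlog2]
      linarith
    linarith
  have hloss : M * (k + 1) ^ 2 ≤ r ^ (-ε) := by
    have hp : 0 < r ^ (-(ε / 2)) := Real.rpow_pos_of_pos hr0 _
    have hM : M ≤ r ^ (-(ε / 2)) := by
      rw [Real.rpow_neg hr0.le, ← one_div, le_div_iff₀ (Real.rpow_pos_of_pos hr0 _)]
      exact hr2
    have hk : ((k : ℝ) + 1) ^ 2 ≤ r ^ (-(ε / 2)) := by
      calc ((k : ℝ) + 1) ^ 2 ≤ (r ^ (-(ε / 4))) ^ 2 := by gcongr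
        _ = r ^ (-(ε / 2)) := by
            rw [← Real.rpow_natCast, ← Real.rpow_mul hr0.le]; congr 1; push_cast; ring
    calc M * (k + 1) ^ 2 ≤ r ^ (-(ε / 2)) * r ^ (-(ε / 2)) :=
          mul_le_mul hM hk (by positivity) hp.le
      _ = r ^ (-ε) := by rw [← Real.rpow_add hr0]; congr 1; ring
  calc capacity s (r ^ (1 / α * (1 - ε))) E
      ≤ capacity s (((2⁻¹ : ℝ) ^ k) ^ (1 / α)) E := by
        refine capacity_anti_radius hs (by positivity) ?_
        rw [mul_comm, Real.rpow_mul hr0.le]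
        gcongr
    _ ≤ ENNReal.ofReal (M * (k + 1) ^ 2) * (boxCount ((2⁻¹ : ℝ) ^ k) A : ℝ≥0∞) := h k
    _ ≤ _ := mul_le_mul' (ENNReal.ofReal_le_ofReal hloss)
        (ENat.toENNReal_le.2 (boxCount_anti A hk2))

lemma inv_mul_le_of_le_mul (hα : 0 < α) {a b : EReal}
    (h : a ≤ ((1 / (1 / α) : ℝ) : EReal) * b) : ((1 / α : ℝ) : EReal) * a ≤ b := by
  calc ((1 / α : ℝ) : EReal) * a ≤ ((1 / α : ℝ) : EReal) * (((1 / (1 / α) : ℝ) : EReal) * b) :=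
        mul_le_mul_of_nonneg_left h (by exact_mod_cast (by positivity : (0 : ℝ) ≤ 1 / α))
    _ = b := by
        rw [← mul_assoc, ← EReal.coe_mul, mul_one_div_cancel (by positivity), EReal.coe_one,
          one_mul]

/-- Two-sided comparison of covering numbers and capacities, up to subpolynomial factors, gives
equality of the dimensions. -/
lemma boxDim_eq_of_eventually (hα : 0 < α) {s : ℝ} {A : Set (EuclideanSpace ℝ (Fin m))}
    (hupper : ∀ ε : ℝ, 0 < ε → ε < 1 → ∀ᶠ r in 𝓝[>] (0 : ℝ),
      (boxCount (r ^ (α * (1 - ε))) A : ℝ≥0∞) ≤ ENNReal.ofReal (r ^ (-ε)) * capacity s r E)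
    (hlower : ∀ ε : ℝ, 0 < ε → ε < 1 → ∀ᶠ r in 𝓝[>] (0 : ℝ),
      capacity s (r ^ (1 / α * (1 - ε))) E ≤
        ENNReal.ofReal (r ^ (-ε)) * (boxCount r A : ℝ≥0∞)) :
    lowerBoxDim A = ((1 / α : ℝ) : EReal) * lowerProfile s E ∧
      upperBoxDim A = ((1 / α : ℝ) : EReal) * upperProfile s E := by
  have hα' : 0 < 1 / α := by positivity
  exact ⟨le_antisymm (liminf_logRatio_le hα hupper)
      (inv_mul_le_of_le_mul hα (liminf_logRatio_le hα' hlower)),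
    le_antisymm (limsup_logRatio_le hα hupper)
      (inv_mul_le_of_le_mul hα (limsup_logRatio_le hα' hlower))⟩

end BoxProfile

theorem corollary2p11 {n m : ℕ} (hm : 0 < m) {α : ℝ} (hα₀ : 0 < α) (hα₁ : α < 1)
    {Ω : Type*} [MeasurableSpace Ω] (P : Measure Ω) [IsProbabilityMeasure P]
    (X : EuclideanSpace ℝ (Fin n) → Ω → EuclideanSpace ℝ (Fin m))
    (hX : BoxProfile.IsFractionalBrownianMotion α X P)
    (E : Set (EuclideanSpace ℝ (Fin n))) (hE : IsCompact E) (hEne : E.Nonempty) :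
    ∀ᵐ ω ∂P,
      BoxProfile.lowerBoxDim ((fun x => X x ω) '' E)
          = ((1 / α : ℝ) : EReal) * BoxProfile.lowerProfile ((m : ℝ) * α) E ∧
      BoxProfile.upperBoxDim ((fun x => X x ω) '' E)
          = ((1 / α : ℝ) : EReal) * BoxProfile.upperProfile ((m : ℝ) * α) E := by
  have hs : 0 ≤ (m : ℝ) * α := by positivity
  obtain ⟨Y, hYm, hYc, hYX⟩ := hX.exists_continuous_version
  -- Hölder continuity of every order below `α`: countably many orders suffice.
  have hhol : ∀ᵐ ω ∂P, ∀ j : ℕ, ∃ c : ℝ, 0 < c ∧ ∀ x ∈ E, ∀ y ∈ E,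
      ‖X x ω - X y ω‖ ≤ c * ‖x - y‖ ^ (α * (1 - 1 / (j + 2))) := by
    refine ae_all_iff.2 fun j => ?_
    have hj : (0 : ℝ) < 1 / (j + 2) := by positivity
    have hj' : (1 : ℝ) / (j + 2) < 1 := by
      rw [div_lt_one (by positivity)]
      have : (0 : ℝ) ≤ j := Nat.cast_nonneg j
      linarith
    exact BoxProfile.ae_exists_holder hX.measurable hX.continuous
      (mul_pos hα₀ (by linarith)) (mul_lt_of_lt_one_right hα₀ (by linarith))
      (hX.exists_moment_bound hm) hE
  have hsmall : ∀ (k : ℕ) (x y : EuclideanSpace ℝ (Fin n)),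
      P {ω | ‖Y x ω - Y y ω‖ ≤ (2⁻¹ : ℝ) ^ k} ≤
        ENNReal.ofReal (BoxProfile.kernel (m * α) (((2⁻¹ : ℝ) ^ k) ^ (1 / α)) (x - y)) := by
    intro k x y
    refine le_trans (measure_mono_ae ?_) (hX.measure_norm_sub_le hα₀ (by positivity) x y)
    filter_upwards [hYX] with ω hω h
    change ‖X x ω - X y ω‖ ≤ _
    rw [← hω, ← hω]
    exact h
  filter_upwards [hX.continuous, hYX, hhol,
    BoxProfile.ae_capacity_le_boxCount hYm hYc hs (fun k => by positivity) hsmall hE hEne]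
    with ω hcont hω hholω ⟨M, _, hM⟩
  simp_rw [hω] at hM
  refine BoxProfile.boxDim_eq_of_eventually hα₀ (fun ε h0 h1 => ?_)
    fun ε h0 _ => BoxProfile.eventually_capacity_le_boxCount hα₀ hs hM h0
  refine BoxProfile.eventually_boxCount_le_capacity hα₀ hE hEne hcont (fun γ hγ hγα => ?_) h0 h1
  obtain ⟨j, hj⟩ := exists_nat_one_div_lt (sub_pos.2 ((div_lt_one hα₀).2 hγα))
  refine BoxProfile.exists_holder_of_le hE hγ ?_ (hholω j)
  have h2 : (1 : ℝ) / (j + 2) ≤ 1 / (j + 1) := by gcongr; norm_num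
  calc γ = α * (γ / α) := by field_simp
    _ ≤ α * (1 - 1 / (j + 2)) := by gcongr; linarith
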